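/- For integers $r\ge1$ and $k_1,\dots,k_r\ge1$ let $$\mathrm{Li}_{k_1,\dots,k_r}(z)=\sum_{0<m_1<\cdots<m_r}\frac{z^{m_r}}{m_1^{k_1}\cdots m_r^{k_r}}\quad(|z|<1),\qquad \xi(k_1,\dots,k_r;s)=\frac1{\Gamma(s)}\int_0^\infty\frac{t^{s-1}}{e^t-1}\,\mathrm{Li}_{k_1,\dots,k_r}(1-e^{-t})\,dt\quad(\Re s>0),$$ and, for integers $k_1,\dots,k_{r-1}\ge1$ and $k_r\ge2$, let $$\zeta^\star(k_1,\dots,k_r)=\sum_{0<m_1\le\cdots\le m_r}\frac1{m_1^{k_1}\cdots m_r^{k_r}}.$$ Write $\{c\}^n$ for $c$ repeated $n$ times, and let $\zeta$ be the Riemann zeta function. The series $\mathrm{Li}_{k_1,\dots,k_r}(1-e^{-t})$ for $t>0$, the integral defining $\xi(k_1,\dots,k_r;m)$ for integers $m\ge1$, and the series $\zeta^\star$ (under the stated conditions on the indices) converge absolutely, and the following hold. (1) For every integer $k\ge0$, $$\sum_{\substack{r+k_1+k_2=k\\ r,k_1,k_2\ge0}}(-1)^{k_2}\,\xi(\{1\}^r,k_1+1;k_2+1)=\begin{cases}\zeta(k+2)&(k\text{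 even}),\\0&(k\text{ odd}).\end{cases}$$ (2) For all integers $r\ge1$ and $k\ge0$, $$\sum_{\substack{k_1+\cdots+k_{r+1}=k\\ k_1,\dots,k_{r+1}\ge0}}(-1)^{k_{r+1}}\,\xi(k_1+1,\dots,k_r+1;k_{r+1}+1)=\sum_{\substack{a+2b=k\\ a,b\ge0}}(-1)^a\binom{a+r-1}{r-1}\,\zeta^\star(a+r+1,\{2\}^b).$$ -/

import Mathlib

open scoped BigOperators

noncomputable section

/-- The tuples `0 < m₁ < ⋯ < m_r` of integers. -/
abbrev StrictTuple (r : ℕ) : Type :=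
  {m : Fin r → ℕ // (∀ i, 0 < m i) ∧ StrictMono m}

/-- The tuples `0 < m₁ ≤ ⋯ ≤ m_r` of integers. -/
abbrev WeakTuple (r : ℕ) : Type :=
  {m : Fin r → ℕ // (∀ i, 0 < m i) ∧ Monotone m}

/-- The last of the `r ≥ 1` positions `0, …, r - 1`. -/
def lastPos (r : ℕ) [NeZero r] : Fin r :=
  ⟨r - 1, Nat.sub_one_lt (NeZero.ne r)⟩

/-- An index `(k₁, …, k_r)` with `k₁, …, k_{r-1} ≥ 1` and `k_r ≥ 2`. -/
def IsAdmissible {r : ℕ} [NeZero r] (k : Fin r → ℕ) : Prop :=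
  (∀ i, 1 ≤ k i) ∧ 2 ≤ k (lastPos r)

/-- The summand `1 / (m₁^{k₁} ⋯ m_r^{k_r})` of the multiple zeta-star value. -/
def zetaStarTerm {r : ℕ} (k : Fin r → ℕ) (m : WeakTuple r) : ℝ :=
  1 / ∏ i, (m.1 i : ℝ) ^ k i

/-- The multiple zeta-star value `ζ⋆(k₁, …, k_r)`, a sum over `0 < m₁ ≤ ⋯ ≤ m_r`. -/
def zetaStar {r : ℕ} (k : Fin r → ℕ) : ℝ :=
  ∑' m : WeakTuple r, zetaStarTerm k m

/-- The summand `z^{m_r} / (m₁^{k₁} ⋯ m_r^{k_r})` of the multiple polylogarithm. -/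
def multiPolylogTerm {r : ℕ} [NeZero r] (k : Fin r → ℕ) (z : ℂ) (m : StrictTuple r) : ℂ :=
  z ^ m.1 (lastPos r) / ∏ i, (m.1 i : ℂ) ^ k i

/-- The multiple polylogarithm `Li_{k₁, …, k_r}(z)`, a sum over `0 < m₁ < ⋯ < m_r`. -/
def multiPolylog {r : ℕ} [NeZero r] (k : Fin r → ℕ) (z : ℂ) : ℂ :=
  ∑' m : StrictTuple r, multiPolylogTerm k z m

/-- The integrand `t^{s-1} / (e^t - 1) * Li_{k₁, …, k_r}(1 - e^{-t})`. -/
def xiIntegrand {r : ℕ} [NeZero r] (k : Fin r → ℕ) (s : ℂ) (t : ℝ) : ℂ :=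
  (t : ℂ) ^ (s - 1) / (Complex.exp t - 1) * multiPolylog k (1 - Complex.exp (-t))

/-- The Arakawa-Kaneko multiple zeta function `ξ(k₁, …, k_r; s)`. -/
def arakawaKanekoXi {r : ℕ} [NeZero r] (k : Fin r → ℕ) (s : ℂ) : ℂ :=
  1 / Complex.Gamma s * ∫ t in Set.Ioi (0 : ℝ), xiIntegrand k s t

/-- The series and the integral that define `ξ(k₁, …, k_r; s)` converge absolutely. -/
def XiConverges {r : ℕ} [NeZero r] (k : Fin r → ℕ) (s : ℂ) : Prop :=
  (∀ t : ℝ, 0 < t → Summable (multiPolylogTerm k (1 - Complex.exp (-t)))) ∧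
    MeasureTheory.IntegrableOn (xiIntegrand k s) (Set.Ioi (0 : ℝ))

end

/-! Everything reduces to series over strictly increasing tuples `m` with largest entry `M`. Since
`(1 - e^{-t}) / (e^t - 1) = e^{-t}`, termwise integration meets `∫ t^q e^{-t} (1 - e^{-t})^{M-1} dt
= q! h_q(M) / M` (`integral_pow_mul_exp_neg_mul`), with `h_q(M)` complete homogeneous in `1, 1/2, …,
1/M`. Hence `ξ(k; q + 1)` is the sum of `∏ m_i^{-k_i} · h_q(M) / M` (`xiConverges_and_eq`); the
bound `h_q(M) ≤ 2^{q+1} √M` gives convergence.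

For (1), fix the last entry `N`. The entries below it, all with exponent 1, contribute elementary
symmetric functions of `1, …, 1/(N-1)`. With `E` and `H` the elementary and complete generating
functions, the contribution of `N` has generating function `E_{N-1}(x) · 1/(N - x) · H_N(-x)/N`. As
`H_N(-x)/N = H_{N-1}(-x)/(N + x)` and `E_{N-1}(x) H_{N-1}(-x) = 1`, this is `1/(N² - x²)`
(`generating_ones_identity`), whose coefficients are summed over `N`.

For (2), compare generating functions for `0 < x ≤ 1/2`. The `ξ` side becomes the sum over `m` of `∏
1/(m_i - x) · (1/M) ∏_{j ≤ M} j/(j + x)`. Introduce the connector `c(N, M) = ∏_{j ≤ M} (j - x)/(j +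
N)` and `Q_N = ∏_{n ≥ N} (1 - x²/n²)⁻¹`. Telescoping gives `∑_m ∏ 1/(m_i - x) · c(N, M) = (N +
x)^{-r}` (`hasSum_strictTuple_connector`), and a Gauss summation gives `∑_N c(N, M) Q_N / N = (1/M)
∏_{j ≤ M} j/(j + x)` (`hasSum_connector_mul_starTailGen`). Summing one double series in both orders
turns the `ξ` side into `∑_N Q_N / (N (N + x)^r)`; expanding `Q_N` and the negative binomial power
yields the `ζ⋆` side. Equality of coefficients follows from `coeff_eq_of_hasSum_eq`. -/

/-! ### Summation tools. -/

theorem HasSum.sigma_of_nonneg {α : Type*} {β : α → Type*} {f : (Σ x, β x) → ℝ} {g : α → ℝ} {a : ℝ}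
    (hf : ∀ x, 0 ≤ f x) (hg : ∀ x, HasSum (fun y => f ⟨x, y⟩) (g x)) (ha : HasSum g a) :
    HasSum f a := by
  refine HasSum.sigma_of_hasSum ha hg ((summable_sigma_of_nonneg hf).2
    ⟨fun x => (hg x).summable, ?_⟩)
  simpa only [(hg _).tsum_eq] using ha.summable

theorem HasSum.prod_of_nonneg {α β : Type*} {f : α × β → ℝ} {g : α → ℝ} {a : ℝ}
    (hf : ∀ x, 0 ≤ f x) (hg : ∀ x, HasSum (fun y => f (x, y)) (g x)) (ha : HasSum g a) :
    HasSum f a := by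
  have hs : Summable f := (summable_prod_of_nonneg hf).2
    ⟨fun x => (hg x).summable, by simpa only [(hg _).tsum_eq] using ha.summable⟩
  have := hs.hasSum.prod_fiberwise hg
  rw [ha.unique this]
  exact hs.hasSum

/-- Telescoping sums with nonnegative terms. -/
theorem hasSum_telescope {u v : ℕ → ℝ} (hv : ∀ j, 0 ≤ v j) (h : ∀ j, v j = u j - u (j + 1))
    (hu : Filter.Tendsto u Filter.atTop (nhds 0)) : HasSum v (u 0) := by
  rw [hasSum_iff_tendsto_nat_of_nonneg hv]
  simp only [h, Finset.sum_range_sub']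
  simpa using hu.const_sub (u 0)

theorem HasSum.congr_of_eq {ι : Type*} {f g : ι → ℝ} {a : ℝ} (h : HasSum f a)
    (e : ∀ x, g x = f x) : HasSum g a := by
  rwa [funext e]

/-- The sum of absolute values is carried along so that the product can be iterated over the
coordinates of a tuple. -/
theorem HasSum.mul_of_abs {ι κ : Type*} {f : ι → ℝ} {g : κ → ℝ} {a b a' b' : ℝ}
    (hf : HasSum f a) (hf' : HasSum (fun i => |f i|) a')
    (hg : HasSum g b) (hg' : HasSum (fun i => |g i|) b') :
    HasSum (fun x : ι × κ => f x.1 * g x.2) (a * b) ∧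
      HasSum (fun x : ι × κ => |f x.1 * g x.2|) (a' * b') := by
  have hs : Summable fun x : ι × κ => f x.1 * g x.2 :=
    summable_mul_of_summable_norm hf'.summable hg'.summable
  have hs' : Summable fun x : ι × κ => |f x.1| * |g x.2| := by
    simpa only [abs_mul] using hs.abs
  refine ⟨hf.mul hg hs, ?_⟩
  simpa only [abs_mul] using hf'.mul hg' hs'

/-- The product of absolutely convergent series as a series over tuples. -/
theorem hasSum_pi_prod {n : ℕ} {f : Fin n → ℕ → ℝ} {a b : Fin n → ℝ}
    (h : ∀ i, HasSum (f i) (a i)) (h' : ∀ i, HasSum (fun j => |f i j|) (b i)) :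
    HasSum (fun κ : Fin n → ℕ => ∏ i, f i (κ i)) (∏ i, a i) ∧
      HasSum (fun κ : Fin n → ℕ => |∏ i, f i (κ i)|) (∏ i, b i) := by
  induction n with
  | zero =>
    constructor
    · simp
    · simp
  | succ n ih =>
    obtain ⟨h1, h2⟩ := ih (fun i => h i.succ) (fun i => h' i.succ)
    obtain ⟨k1, k2⟩ := (h 0).mul_of_abs (h' 0) h1 h2
    constructor
    · rw [← (Fin.consEquiv (n := n) (fun _ => ℕ)).hasSum_iff, Fin.prod_univ_succ]
      refine k1.congr_of_eq fun x => ?_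
      simp [Fin.prod_univ_succ, Fin.consEquiv]
    · rw [← (Fin.consEquiv (n := n) (fun _ => ℕ)).hasSum_iff, Fin.prod_univ_succ]
      refine k2.congr_of_eq fun x => ?_
      simp [Fin.prod_univ_succ, Fin.consEquiv, abs_mul]

/-- The identity theorem for power series, from equality at small positive reals. -/
theorem coeff_eq_of_hasSum_eq {a b : ℕ → ℝ} {ρ : ℝ} (hρ : 0 < ρ)
    (h : ∀ x, 0 < x → x ≤ ρ → ∃ s, HasSum (fun k => a k * x ^ k) s ∧
      HasSum (fun k => b k * x ^ k) s) : a = b := by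
  suffices H : ∀ c : ℕ → ℝ, (∀ x, 0 < x → x ≤ ρ → HasSum (fun k => c k * x ^ k) 0) →
      ∀ k, c k = 0 by
    funext k
    refine sub_eq_zero.1 (H (fun k => a k - b k) (fun x h0 h1 => ?_) k)
    obtain ⟨s, h2, h3⟩ := h x h0 h1
    simpa [sub_mul] using h2.sub h3
  intro c hc k
  induction k using Nat.strong_induction_on with
  | _ k ih =>
    -- The coefficients below `k` vanish by induction, so the series may be divided by `x ^ k`,
    -- which makes `c k` its constant term.
    have hS : ∀ x, 0 < x → x ≤ ρ → HasSum (fun j => c (j + k) * x ^ j) 0 := by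
      intro x h0 h1
      have h2 : HasSum (fun j => c (j + k) * x ^ (j + k)) 0 := by
        have h3 := (hasSum_nat_add_iff' k).2 (hc x h0 h1)
        rwa [Finset.sum_eq_zero (fun i hi => by rw [ih i (Finset.mem_range.1 hi), zero_mul]),
          sub_zero] at h3
      have h3 := h2.mul_left ((x ^ k)⁻¹)
      rw [mul_zero] at h3
      convert! h3 using 2 with j
      field_simp
      ring
    have hA : Summable (fun j => |c (j + 1 + k)| * ρ ^ j) := by
      have := ((summable_nat_add_iff 1).2 (hS ρ hρ le_rfl).summable).abs.mul_left (ρ⁻¹)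
      convert! this using 2 with j
      rw [abs_mul, abs_of_pos (pow_pos hρ _)]
      field_simp
      ring
    set C := ∑' j, |c (j + 1 + k)| * ρ ^ j with hC
    -- What follows the constant term is `x` times a series bounded by `C` uniformly in `x ≤ ρ`;
    -- letting `x → 0` kills it.
    have hb : ∀ x, 0 < x → x ≤ ρ → |c k| ≤ x * C := by
      intro x h0 h1
      have h2 := (hasSum_nat_add_iff' 1).2 (hS x h0 h1)
      simp only [Finset.sum_range_one, pow_zero, mul_one, zero_add, zero_sub] at h2
      have h3 : |c k| = ‖∑' j, c (j + 1 + k) * x ^ (j + 1)‖ := by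
        rw [h2.tsum_eq, norm_neg, Real.norm_eq_abs]
      rw [h3]
      refine tsum_of_norm_bounded (hA.hasSum.mul_left x) (fun j => ?_)
      rw [Real.norm_eq_abs, abs_mul, abs_of_pos (pow_pos h0 _), pow_succ]
      calc |c (j + 1 + k)| * (x ^ j * x) = x * (|c (j + 1 + k)| * x ^ j) := by ring
        _ ≤ _ := by gcongr
    have hlim : Filter.Tendsto (fun x : ℝ => x * C) (nhdsWithin 0 (Set.Ioi 0)) (nhds 0) := by
      have : Filter.Tendsto (fun x : ℝ => x * C) (nhds 0) (nhds (0 * C)) :=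
        (continuous_id.mul continuous_const).tendsto 0
      rw [zero_mul] at this
      exact this.mono_left nhdsWithin_le_nhds
    have : |c k| ≤ 0 := by
      refine ge_of_tendsto hlim ?_
      filter_upwards [Ioc_mem_nhdsGT hρ] with x hx using hb x hx.1 hx.2
    exact abs_eq_zero.1 (le_antisymm this (abs_nonneg _))

/-- Summability over tuples bounded by their top entry. -/
theorem summable_prod_inv_div_sqrt {ι : Type*} {r : ℕ} (hr : r ≠ 0) {m : ι → Fin r → ℕ}
    (hm : Function.Injective m) {T : ι → ℕ} (hpos : ∀ a i, 0 < m a i) (hT : ∀ a i, m a i ≤ T a) :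
    Summable fun a => (∏ i, 1 / (m a i : ℝ)) * (1 / Real.sqrt (T a)) := by
  -- The factor `T^{-1/2}` is shared equally among the `r` entries: each gets `T^{-δ} ≤ m_i^{-δ}`,
  -- and `∑ n^{-1-δ}` converges.
  set δ : ℝ := 1 / (2 * r) with hδ
  have hr' : (0 : ℝ) < r := by positivity
  have hδ0 : 0 < δ := by positivity
  have hs : HasSum (fun n : ℕ => 1 / (n : ℝ) ^ (1 + δ)) (∑' n : ℕ, 1 / (n : ℝ) ^ (1 + δ)) :=
    (Real.summable_one_div_nat_rpow.2 (by linarith)).hasSum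
  have hs' : HasSum (fun n : ℕ => |1 / (n : ℝ) ^ (1 + δ)|) (∑' n : ℕ, 1 / (n : ℝ) ^ (1 + δ)) := by
    convert! hs using 2 with n
    exact abs_of_nonneg (by positivity)
  have h1 := (hasSum_pi_prod (n := r) (fun _ => hs) (fun _ => hs')).1.summable
  refine Summable.of_nonneg_of_le (fun a => by positivity) (fun a => ?_) (h1.comp_injective hm)
  have hTpos : (0 : ℝ) < T a := by
    have := (hpos a ⟨0, Nat.pos_of_ne_zero hr⟩).trans_le (hT a _)
    exact_mod_cast this
  have h2 : Real.sqrt (T a) = ∏ _i : Fin r, (T a : ℝ) ^ δ := by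
    rw [Finset.prod_const, Finset.card_univ, Fintype.card_fin, ← Real.rpow_natCast,
      ← Real.rpow_mul hTpos.le, Real.sqrt_eq_rpow]
    congr 1
    rw [hδ]; field_simp
  rw [h2, one_div, ← Finset.prod_inv_distrib, ← Finset.prod_mul_distrib]
  refine Finset.prod_le_prod (fun i _ => by positivity) (fun i _ => ?_)
  have hmi : (0 : ℝ) < m a i := by exact_mod_cast hpos a i
  have hle : (m a i : ℝ) ≤ T a := by exact_mod_cast hT a i
  rw [Real.rpow_add hmi, Real.rpow_one, one_div, one_div, mul_inv]
  gcongr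

/-! ### Complete harmonic sums: generating function and growth. -/

/-- The complete homogeneous symmetric polynomial of degree `q` in `1, 1/2, …, 1/M`. -/
noncomputable def completeHarmonic : ℕ → ℕ → ℝ
  | 0, _ => 1
  | q + 1, M => ∑ j ∈ Finset.range M, completeHarmonic q (j + 1) / (j + 1)

theorem completeHarmonic_zero (M : ℕ) : completeHarmonic 0 M = 1 := by
  rw [completeHarmonic]

theorem completeHarmonic_succ_zero (q : ℕ) : completeHarmonic (q + 1) 0 = 0 := by
  rw [completeHarmonic, Finset.sum_range_zero]

theorem completeHarmonic_succ_succ (q M : ℕ) : completeHarmonic (q + 1) (M + 1) =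
    completeHarmonic (q + 1) M + completeHarmonic q (M + 1) / (M + 1) := by
  simp only [completeHarmonic, Finset.sum_range_succ]

theorem completeHarmonic_one (q : ℕ) : completeHarmonic q 1 = 1 := by
  induction q with
  | zero => exact completeHarmonic_zero 1
  | succ q ih => rw [completeHarmonic_succ_succ, completeHarmonic_succ_zero, zero_add, ih]; simp

theorem completeHarmonic_nonneg (q M : ℕ) : 0 ≤ completeHarmonic q M := by
  induction q generalizing M with
  | zero => rw [completeHarmonic_zero]; exact zero_le_one
  | succ q ih =>
    rw [completeHarmonic]
    exact Finset.sum_nonneg fun j _ => div_nonneg (ih _) (by positivity)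

/-- The right side is the full generating function. The recursion in `M` shifts `q` by one, so on
partial sums it loses only a nonnegative top term; working with partial sums avoids presupposing the
convergence that this bound supplies. -/
theorem sum_pow_mul_completeHarmonic_le {x : ℝ} (h0 : 0 ≤ x) (h1 : x < 1) (M N : ℕ) :
    ∑ q ∈ Finset.range N, x ^ q * completeHarmonic q M ≤
      ∏ j ∈ Finset.range M, ((j : ℝ) + 1) / (j + 1 - x) := by
  induction M with
  | zero =>
    cases N with
    | zero => simp
    | succ N =>
      rw [Finset.sum_range_succ']
      simp [completeHarmonic_succ_zero, completeHarmonic_zero]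
  | succ M ih =>
    have key : ∑ q ∈ Finset.range N, x ^ q * completeHarmonic q (M + 1) ≤
        ∑ q ∈ Finset.range N, x ^ q * completeHarmonic q M +
          x / (M + 1) * ∑ q ∈ Finset.range N, x ^ q * completeHarmonic q (M + 1) := by
      cases N with
      | zero => simp
      | succ N =>
        nth_rewrite 1 [Finset.sum_range_succ']
        nth_rewrite 1 [Finset.sum_range_succ' (fun q => x ^ q * completeHarmonic q M)]
        rw [Finset.sum_range_succ (fun q => x ^ q * completeHarmonic q (M + 1)) N]
        have e : ∀ q, x ^ (q + 1) * completeHarmonic (q + 1) (M + 1) =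
            x ^ (q + 1) * completeHarmonic (q + 1) M +
              x / (M + 1) * (x ^ q * completeHarmonic q (M + 1)) := by
          intro q
          rw [completeHarmonic_succ_succ]
          ring
        simp only [e, Finset.sum_add_distrib, ← Finset.mul_sum, completeHarmonic_zero]
        have : 0 ≤ x / (M + 1) * (x ^ N * completeHarmonic N (M + 1)) :=
          mul_nonneg (by positivity) (mul_nonneg (by positivity) (completeHarmonic_nonneg _ _))
        linarith
    rw [Finset.prod_range_succ]
    have hM : (0 : ℝ) < M + 1 - x := by
      have : (0 : ℝ) ≤ M := Nat.cast_nonneg M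
      linarith
    have hM' : (0 : ℝ) < M + 1 := by positivity
    set S := ∑ q ∈ Finset.range N, x ^ q * completeHarmonic q (M + 1)
    rw [← mul_div_assoc, le_div_iff₀ hM]
    calc S * (M + 1 - x) = (S - x / (M + 1) * S) * (M + 1) := by field_simp
      _ ≤ _ := by
        refine mul_le_mul_of_nonneg_right ?_ hM'.le
        linarith

/-- The worst case is `x = 1/2`, where the induction comes down to `(M + 1)(M + 2) ≤ (M + 3/2)²`. -/
theorem prod_div_sub_le_sqrt {x : ℝ} (h1 : x ≤ 1 / 2) (M : ℕ) :
    ∏ j ∈ Finset.range (M + 1), ((j : ℝ) + 1) / (j + 1 - x) ≤ 2 * Real.sqrt ((M + 1 : ℕ) : ℝ) := by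
  induction M with
  | zero =>
    simp only [zero_add, Finset.prod_range_one, Nat.cast_zero, Nat.cast_one, Real.sqrt_one]
    rw [div_le_iff₀ (by linarith)]
    linarith
  | succ M ih =>
    rw [Finset.prod_range_succ]
    have hM : (0 : ℝ) ≤ M := Nat.cast_nonneg M
    have hp : (0 : ℝ) < ((M + 1 : ℕ) : ℝ) + 1 - x := by push_cast; linarith
    calc _ ≤ 2 * Real.sqrt ((M + 1 : ℕ) : ℝ) * (((M + 1 : ℕ) + 1) / ((M + 1 : ℕ) + 1 - x)) := by
          refine mul_le_mul_of_nonneg_right ih (by positivity)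
      _ ≤ 2 * Real.sqrt ((M + 1 : ℕ) : ℝ) * (((M : ℝ) + 2) / (M + 3 / 2)) := by
          have : (((M + 1 : ℕ) : ℝ) + 1) / ((M + 1 : ℕ) + 1 - x) ≤ ((M : ℝ) + 2) / (M + 3 / 2) := by
            push_cast
            rw [div_le_div_iff₀ (by linarith) (by positivity)]
            nlinarith
          gcongr
      _ ≤ _ := by
          have : Real.sqrt ((M + 1 : ℕ) : ℝ) * (((M : ℝ) + 2) / (M + 3 / 2)) ≤
              Real.sqrt ((M + 1 + 1 : ℕ) : ℝ) := by
            apply Real.le_sqrt_of_sq_le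
            rw [mul_pow, Real.sq_sqrt (by positivity), div_pow, ← mul_div_assoc,
              div_le_iff₀ (by positivity)]
            push_cast
            nlinarith
          linarith

theorem summable_pow_mul_completeHarmonic {x : ℝ} (h0 : 0 ≤ x) (h1 : x < 1) (M : ℕ) :
    Summable (fun q => x ^ q * completeHarmonic q M) :=
  summable_of_sum_range_le (fun q => mul_nonneg (by positivity) (completeHarmonic_nonneg _ _))
    (sum_pow_mul_completeHarmonic_le h0 h1 M)

theorem tsum_pow_mul_completeHarmonic_le {x : ℝ} (h0 : 0 ≤ x) (h1 : x ≤ 1 / 2) {M : ℕ}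
    (hM : 0 < M) : ∑' q, x ^ q * completeHarmonic q M ≤ 2 * Real.sqrt M := by
  obtain ⟨M, rfl⟩ := Nat.exists_eq_succ_of_ne_zero hM.ne'
  exact Real.tsum_le_of_sum_range_le
    (fun q => mul_nonneg (by positivity) (completeHarmonic_nonneg _ _))
    (fun N => (sum_pow_mul_completeHarmonic_le h0 (by linarith) _ N).trans
      (prod_div_sub_le_sqrt h1 M))

/-- A single term of the generating series at `x = 1/2` is at most the whole sum. -/
theorem completeHarmonic_le (q : ℕ) {M : ℕ} (hM : 0 < M) :
    completeHarmonic q M ≤ 2 ^ (q + 1) * Real.sqrt M := by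
  have h := (summable_pow_mul_completeHarmonic (x := 1 / 2) (by norm_num) (by norm_num)
    M).le_tsum q (fun j _ => mul_nonneg (by positivity) (completeHarmonic_nonneg _ _))
  have h' := h.trans (tsum_pow_mul_completeHarmonic_le (by norm_num) le_rfl hM)
  rw [one_div, inv_pow, inv_mul_le_iff₀ (by positivity)] at h'
  rw [pow_succ]
  linarith

theorem hasSum_neg_pow_mul_completeHarmonic {x : ℝ} (h0 : 0 ≤ x) (h1 : x < 1) (M : ℕ) :
    HasSum (fun q => (-x) ^ q * completeHarmonic q M)
      (∏ j ∈ Finset.range M, ((j : ℝ) + 1) / (j + 1 + x)) := by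
  have hs : ∀ M, Summable (fun q => (-x) ^ q * completeHarmonic q M) := fun M => by
    refine Summable.of_norm_bounded (summable_pow_mul_completeHarmonic h0 h1 M) (fun q => ?_)
    rw [norm_mul, norm_pow, norm_neg, Real.norm_of_nonneg h0,
      Real.norm_of_nonneg (completeHarmonic_nonneg _ _)]
  induction M with
  | zero =>
    have := hasSum_single (f := fun q => (-x) ^ q * completeHarmonic q 0) 0 (fun q hq => by
      obtain ⟨q, rfl⟩ := Nat.exists_eq_succ_of_ne_zero hq
      simp [completeHarmonic_succ_zero])
    simpa [completeHarmonic_zero] using this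
  | succ M ih =>
    obtain ⟨s, hsM⟩ := hs (M + 1)
    have h2 : HasSum (fun q => (-x) ^ (q + 1) * completeHarmonic (q + 1) (M + 1)) (s - 1) := by
      simpa [completeHarmonic_zero] using (hasSum_nat_add_iff' 1).2 hsM
    have h3 : HasSum (fun q => (-x) ^ (q + 1) * completeHarmonic (q + 1) M)
        (∏ j ∈ Finset.range M, ((j : ℝ) + 1) / (j + 1 + x) - 1) := by
      simpa [completeHarmonic_zero] using (hasSum_nat_add_iff' 1).2 ih
    have h4 := h2.unique ((h3.add (hsM.mul_left (-x / (M + 1)))).congr_of_eq (fun q => by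
      rw [completeHarmonic_succ_succ]; ring))
    have hM : (M : ℝ) + 1 + x ≠ 0 := by positivity
    rw [Finset.prod_range_succ]
    convert! hsM using 1
    have hM' : (M : ℝ) + 1 ≠ 0 := by positivity
    field_simp at h4 ⊢
    linear_combination -h4

/-! ### Mellin integrals and termwise integration. -/

section

open MeasureTheory Filter Topology Set

theorem integrableOn_pow_mul_exp_neg (q : ℕ) :
    IntegrableOn (fun t : ℝ => t ^ q * Real.exp (-t)) (Ioi 0) := by
  have := Real.GammaIntegral_convergent (s := q + 1) (by positivity)
  refine this.congr_fun (fun t ht => ?_) measurableSet_Ioi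
  simp [mul_comm]

theorem integral_pow_mul_exp_neg (q : ℕ) :
    ∫ t in Ioi (0 : ℝ), t ^ q * Real.exp (-t) = q.factorial := by
  rw [← Real.Gamma_nat_eq_factorial, Real.Gamma_eq_integral (by positivity)]
  refine setIntegral_congr_fun measurableSet_Ioi (fun t ht => ?_)
  simp [mul_comm]

theorem one_sub_exp_neg_mem {t : ℝ} (ht : 0 < t) :
    0 < 1 - Real.exp (-t) ∧ 1 - Real.exp (-t) < 1 := by
  have h1 : Real.exp (-t) < 1 := by simpa using ht
  have h2 := Real.exp_pos (-t)
  constructor <;> linarith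

theorem integrableOn_pow_mul_exp_neg_mul (q M : ℕ) :
    IntegrableOn (fun t : ℝ => t ^ q * Real.exp (-t) * (1 - Real.exp (-t)) ^ M) (Ioi 0) := by
  refine Integrable.mono' (integrableOn_pow_mul_exp_neg q) ?_ ?_
  · exact Continuous.aestronglyMeasurable (by fun_prop)
  · filter_upwards [ae_restrict_mem measurableSet_Ioi] with t ht
    obtain ⟨h1, h2⟩ := one_sub_exp_neg_mem ht
    have ht' : (0 : ℝ) < t := ht
    rw [Real.norm_of_nonneg (by positivity)]
    exact mul_le_of_le_one_right (by positivity) (pow_le_one₀ h1.le h2.le)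

theorem tendsto_pow_mul_exp_neg_mul (q M : ℕ) :
    Tendsto (fun t : ℝ => t ^ q * Real.exp (-t) * (1 - Real.exp (-t)) ^ M) atTop (𝓝 0) := by
  have h1 := Real.tendsto_pow_mul_exp_neg_atTop_nhds_zero q
  have h2 : Tendsto (fun t : ℝ => (1 - Real.exp (-t)) ^ M) atTop (𝓝 ((1 - 0) ^ M)) :=
    (tendsto_const_nhds.sub Real.tendsto_exp_neg_atTop_nhds_zero).pow M
  simpa using h1.mul h2

/-- Integration by parts: the derivative of `t^{q+1} e^{-t} (1 - e^{-t})^{M+1}` integrates to zero,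
and the `e^{-2t}` that appears is rewritten by `e^{-t} = 1 - (1 - e^{-t})`. -/
theorem integral_pow_mul_exp_neg_mul_succ (q M : ℕ) :
    ((M : ℝ) + 2) * ∫ t in Ioi (0 : ℝ), t ^ (q + 1) * Real.exp (-t) * (1 - Real.exp (-t)) ^ (M + 1) =
      (q + 1) * (∫ t in Ioi (0 : ℝ), t ^ q * Real.exp (-t) * (1 - Real.exp (-t)) ^ (M + 1)) +
      (M + 1) * ∫ t in Ioi (0 : ℝ), t ^ (q + 1) * Real.exp (-t) * (1 - Real.exp (-t)) ^ M := by
  have i1 := (integrableOn_pow_mul_exp_neg_mul q (M + 1)).const_mul ((q : ℝ) + 1)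
  have i2 := (integrableOn_pow_mul_exp_neg_mul (q + 1) M).const_mul ((M : ℝ) + 1)
  have i3 := (integrableOn_pow_mul_exp_neg_mul (q + 1) (M + 1)).const_mul ((M : ℝ) + 2)
  have h := integral_Ioi_of_hasDerivAt_of_tendsto (a := 0)
    (f := fun t : ℝ => t ^ (q + 1) * Real.exp (-t) * (1 - Real.exp (-t)) ^ (M + 1))
    (Continuous.continuousWithinAt (by fun_prop)) (fun t _ => ?_) ((i1.add i2).sub i3)
    (tendsto_pow_mul_exp_neg_mul (q + 1) (M + 1))
  · rw [integral_sub' (i1.add i2) i3, integral_add' i1 i2] at h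
    simp only [integral_const_mul] at h
    simp at h
    linarith
  · have d1 : HasDerivAt (fun t : ℝ => Real.exp (-t)) (-Real.exp (-t)) t := by
      simpa using (hasDerivAt_neg t).exp
    have d2 := ((hasDerivAt_pow (q + 1) t).mul d1).mul ((d1.const_sub 1).pow (M + 1))
    convert! d2 using 1
    simp only [Pi.add_apply, Pi.sub_apply, Pi.mul_apply, Pi.pow_apply, Nat.add_sub_cancel]
    push_cast
    ring

theorem integral_exp_neg_mul_pow (M : ℕ) :
    ((M : ℝ) + 1) * ∫ t in Ioi (0 : ℝ), Real.exp (-t) * (1 - Real.exp (-t)) ^ M = 1 := by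
  have i1 : IntegrableOn (fun t : ℝ => ((M : ℝ) + 1) * (Real.exp (-t) * (1 - Real.exp (-t)) ^ M))
      (Ioi 0) := by
    have := (integrableOn_pow_mul_exp_neg_mul 0 M).const_mul ((M : ℝ) + 1)
    simp only [pow_zero, one_mul] at this
    exact this
  have lim : Tendsto (fun t : ℝ => (1 - Real.exp (-t)) ^ (M + 1)) atTop (𝓝 1) := by
    simpa using (tendsto_const_nhds.sub Real.tendsto_exp_neg_atTop_nhds_zero).pow (M + 1)
      (x := (1 - 0 : ℝ))
  have h := integral_Ioi_of_hasDerivAt_of_tendsto (a := 0)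
    (f := fun t : ℝ => (1 - Real.exp (-t)) ^ (M + 1))
    (Continuous.continuousWithinAt (by fun_prop)) (fun t _ => ?_) i1 lim
  · simpa [integral_const_mul] using h
  · have d1 : HasDerivAt (fun t : ℝ => Real.exp (-t)) (-Real.exp (-t)) t := by
      simpa using (hasDerivAt_neg t).exp
    convert! (d1.const_sub 1).pow (M + 1) using 1
    simp only [Nat.add_sub_cancel]
    push_cast
    ring

/-- The Mellin-type integral that produces complete harmonic sums. -/
theorem integral_pow_mul_exp_neg_mul (q M : ℕ) :
    ((M : ℝ) + 1) * ∫ t in Ioi (0 : ℝ), t ^ q * Real.exp (-t) * (1 - Real.exp (-t)) ^ M =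
      q.factorial * completeHarmonic q (M + 1) := by
  induction q generalizing M with
  | zero => simpa [completeHarmonic_zero] using integral_exp_neg_mul_pow M
  | succ q ihq =>
    induction M with
    | zero => simp [completeHarmonic_one, integral_pow_mul_exp_neg]
    | succ M ih =>
      -- The integration by parts is the recursion `completeHarmonic_succ_succ` in disguise, hence
      -- the double induction on `q` and `M`.
      have h1 := integral_pow_mul_exp_neg_mul_succ q M
      have h2 := ihq (M + 1)
      rw [ih] at h1
      rw [completeHarmonic_succ_succ q (M + 1)]
      rw [Nat.factorial_succ] at h1 ⊢
      push_cast at *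
      have : (M : ℝ) + 1 + 1 ≠ 0 := by positivity
      have h3 : ∫ t in Ioi (0 : ℝ), t ^ q * Real.exp (-t) * (1 - Real.exp (-t)) ^ (M + 1) =
          q.factorial * completeHarmonic q (M + 1 + 1) / (M + 1 + 1) := by
        rw [eq_div_iff this, ← h2]; ring
      rw [h3] at h1
      linear_combination h1

/-- Measurability comes from the almost everywhere limit of finite partial sums, finiteness from
exchanging the sum with the integral of norms. -/
theorem integrable_tsum_of_summable_integral_norm {α ι E : Type*} [MeasurableSpace α]
    [NormedAddCommGroup E] [NormedSpace ℝ E]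
    {μ : Measure α} [Countable ι] {F : ι → α → E} (hF : ∀ i, Integrable (F i) μ)
    (hs : Summable fun i => ∫ a, ‖F i a‖ ∂μ) (h : ∀ᵐ a ∂μ, Summable fun i => F i a) :
    Integrable (fun a => ∑' i, F i a) μ := by
  refine ⟨aestronglyMeasurable_of_tendsto_ae (atTop : Filter (Finset ι))
    (f := fun s a => ∑ i ∈ s, F i a) (fun s => ?_) ?_, ?_⟩
  · exact Finset.aestronglyMeasurable_fun_sum s (fun i _ => (hF i).1)
  · filter_upwards [h] with a ha using ha.hasSum
  · have h1 : ∀ i, ∫⁻ a, ‖F i a‖ₑ ∂μ = ENNReal.ofReal (∫ a, ‖F i a‖ ∂μ) := fun i =>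
      (ofReal_integral_norm_eq_lintegral_enorm (hF i)).symm
    calc ∫⁻ a, ‖∑' i, F i a‖ₑ ∂μ ≤ ∫⁻ a, ∑' i, ‖F i a‖ₑ ∂μ := by
          refine lintegral_mono_ae ?_
          filter_upwards with a using enorm_tsum_le_tsum_enorm
      _ = ∑' i, ENNReal.ofReal (∫ a, ‖F i a‖ ∂μ) := by
          rw [lintegral_tsum (fun i => (hF i).1.enorm)]
          simp only [h1]
      _ < ⊤ := by
          rw [← ENNReal.ofReal_tsum_of_nonneg (fun i => by positivity) hs]
          exact ENNReal.ofReal_lt_top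

/-! ### The values of `ξ` as series over strictly increasing tuples. -/

/-- The largest entry of a tuple, `0` for the empty tuple. -/
def tupleMax {r : ℕ} (m : Fin r → ℕ) : ℕ := Finset.univ.sup m

theorem le_tupleMax {r : ℕ} (m : Fin r → ℕ) (i : Fin r) : m i ≤ tupleMax m :=
  Finset.le_sup (f := m) (Finset.mem_univ i)

theorem tupleMax_eq {r : ℕ} [NeZero r] {m : Fin r → ℕ} (hm : Monotone m) :
    tupleMax m = m (lastPos r) := by
  refine le_antisymm (Finset.sup_le fun i _ => hm ?_) (le_tupleMax m _)
  rw [Fin.le_def, lastPos]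
  have := i.2
  simp only
  omega

theorem StrictTuple.tupleMax_eq {r : ℕ} [NeZero r] (m : StrictTuple r) :
    tupleMax m.1 = m.1 (lastPos r) :=
  _root_.tupleMax_eq m.2.2.monotone

theorem StrictTuple.tupleMax_pos {r : ℕ} [NeZero r] (m : StrictTuple r) : 0 < tupleMax m.1 := by
  rw [m.tupleMax_eq]
  exact m.2.1 _

theorem summable_strictTuple (r : ℕ) [NeZero r] : Summable fun m : StrictTuple r =>
    (∏ i, 1 / (m.1 i : ℝ)) * (1 / Real.sqrt (tupleMax m.1)) :=
  summable_prod_inv_div_sqrt (NeZero.ne r) (m := fun m : StrictTuple r => m.1)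
    Subtype.val_injective (fun m i => m.2.1 i) (fun m i => le_tupleMax m.1 i)

theorem inv_pow_le_inv {n k : ℕ} (hn : 0 < n) (hk : 1 ≤ k) : 1 / (n : ℝ) ^ k ≤ 1 / (n : ℝ) := by
  have h1 : (1 : ℝ) ≤ n := by exact_mod_cast hn
  exact one_div_le_one_div_of_le (by positivity) (le_self_pow₀ h1 (by omega))

theorem prod_inv_pow_le {r : ℕ} {k m : Fin r → ℕ} (hm : ∀ i, 0 < m i) (hk : ∀ i, 1 ≤ k i) :
    ∏ i, 1 / (m i : ℝ) ^ k i ≤ ∏ i, 1 / (m i : ℝ) :=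
  Finset.prod_le_prod (fun i _ => by positivity) (fun i _ => inv_pow_le_inv (hm i) (hk i))

/-- The summand of the series for `ξ(k₁, …, k_r; q + 1)`. -/
noncomputable def xiTerm {r : ℕ} (k : Fin r → ℕ) (q : ℕ) (m : StrictTuple r) : ℝ :=
  (∏ i, 1 / (m.1 i : ℝ) ^ k i) * (completeHarmonic q (tupleMax m.1) / tupleMax m.1)

theorem xiTerm_nonneg {r : ℕ} (k : Fin r → ℕ) (q : ℕ) (m : StrictTuple r) : 0 ≤ xiTerm k q m :=
  mul_nonneg (by positivity) (div_nonneg (completeHarmonic_nonneg _ _) (by positivity))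

theorem div_le_div_sqrt {c h M : ℝ} (hM : 0 < M) (hh : h ≤ c * Real.sqrt M) :
    h / M ≤ c * (1 / Real.sqrt M) := by
  have hs := Real.sqrt_pos.2 hM
  rw [div_le_iff₀ hM]
  calc h ≤ c * Real.sqrt M := hh
    _ = c * (1 / Real.sqrt M) * (Real.sqrt M * Real.sqrt M) := by field_simp
    _ = _ := by rw [Real.mul_self_sqrt hM.le]

theorem summable_xiTerm {r : ℕ} [NeZero r] {k : Fin r → ℕ} (hk : ∀ i, 1 ≤ k i) (q : ℕ) :
    Summable (xiTerm k q) := by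
  refine Summable.of_nonneg_of_le (xiTerm_nonneg k q) (fun m => ?_)
    ((summable_strictTuple r).mul_left (2 ^ (q + 1)))
  have h1 := prod_inv_pow_le m.2.1 hk
  have hM : (0 : ℝ) < tupleMax m.1 := by exact_mod_cast m.tupleMax_pos
  have h2 := div_le_div_sqrt hM (completeHarmonic_le q m.tupleMax_pos)
  calc xiTerm k q m ≤ (∏ i, 1 / (m.1 i : ℝ)) * (2 ^ (q + 1) * (1 / Real.sqrt (tupleMax m.1))) :=
        mul_le_mul h1 h2 (div_nonneg (completeHarmonic_nonneg _ _) hM.le) (by positivity)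
    _ = _ := by ring

/-- The real multiple polylogarithm series converges on `[0, 1)`. -/
theorem summable_multiPolylog_real {r : ℕ} [NeZero r] {k : Fin r → ℕ} (hk : ∀ i, 1 ≤ k i)
    {z : ℝ} (h0 : 0 ≤ z) (h1 : z < 1) :
    Summable fun m : StrictTuple r => (∏ i, 1 / (m.1 i : ℝ) ^ k i) * z ^ tupleMax m.1 := by
  have hz : Summable fun n : ℕ => (n : ℝ) ^ 1 * z ^ n :=
    summable_pow_mul_geometric_of_norm_lt_one 1 (by rwa [Real.norm_of_nonneg h0])
  set C := ∑' n : ℕ, (n : ℝ) ^ 1 * z ^ n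
  refine Summable.of_nonneg_of_le (fun m => by positivity) (fun m => ?_)
    ((summable_strictTuple r).mul_left C)
  have h2 := prod_inv_pow_le m.2.1 hk
  have hM : (1 : ℝ) ≤ tupleMax m.1 := by exact_mod_cast m.tupleMax_pos
  have h3 : (tupleMax m.1 : ℝ) ^ 1 * z ^ tupleMax m.1 ≤ C :=
    hz.le_tsum (tupleMax m.1) (fun n _ => by positivity)
  have hC : 0 ≤ C := tsum_nonneg fun n => by positivity
  have h4 : z ^ tupleMax m.1 ≤ C * (1 / Real.sqrt (tupleMax m.1)) := by
    rw [mul_one_div, le_div_iff₀ (Real.sqrt_pos.2 (by linarith))]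
    have : Real.sqrt (tupleMax m.1) ≤ tupleMax m.1 := by
      rw [Real.sqrt_le_left (by linarith)]
      nlinarith
    calc z ^ tupleMax m.1 * Real.sqrt (tupleMax m.1) ≤ z ^ tupleMax m.1 * tupleMax m.1 := by gcongr
      _ ≤ C := by linarith
  calc _ ≤ (∏ i, 1 / (m.1 i : ℝ)) * (C * (1 / Real.sqrt (tupleMax m.1))) :=
        mul_le_mul h2 h4 (by positivity) (by positivity)
    _ = _ := by ring

theorem multiPolylogTerm_ofReal {r : ℕ} [NeZero r] (k : Fin r → ℕ) (z : ℝ) (m : StrictTuple r) :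
    multiPolylogTerm k (z : ℂ) m =
      (((∏ i, 1 / (m.1 i : ℝ) ^ k i) * z ^ tupleMax m.1 : ℝ) : ℂ) := by
  rw [multiPolylogTerm, m.tupleMax_eq]
  push_cast
  rw [div_eq_inv_mul]
  simp [Finset.prod_inv_distrib]

/-- All terms are nonnegative for `t > 0`, so the integrals of the norms are the values `q! ·
xiTerm`; their summability gives both the integrability and the exchange of sum and integral. -/
theorem xiConverges_and_eq {r : ℕ} [NeZero r] {k : Fin r → ℕ} (hk : ∀ i, 1 ≤ k i) (q : ℕ) :
    XiConverges k ((q : ℂ) + 1) ∧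
      arakawaKanekoXi k ((q : ℂ) + 1) = ((∑' m, xiTerm k q m : ℝ) : ℂ) := by
  have hz : ∀ t : ℝ, 1 - Complex.exp (-(t : ℂ)) = ((1 - Real.exp (-t) : ℝ) : ℂ) := fun t => by
    push_cast; rfl
  have hLi : ∀ t : ℝ, 0 < t → Summable (multiPolylogTerm k (1 - Complex.exp (-(t : ℂ)))) := by
    intro t ht
    obtain ⟨h0, h1⟩ := one_sub_exp_neg_mem ht
    simp only [hz, funext (multiPolylogTerm_ofReal k _)]
    exact Complex.summable_ofReal.2 (summable_multiPolylog_real hk h0.le h1)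
  set F : StrictTuple r → ℝ → ℝ := fun m t => (∏ i, 1 / (m.1 i : ℝ) ^ k i) *
    (t ^ q * Real.exp (-t) * (1 - Real.exp (-t)) ^ (tupleMax m.1 - 1)) with hF
  have hFc : ∀ m (t : ℝ), 0 < t → ((F m t : ℝ) : ℂ) =
      (t : ℂ) ^ ((q : ℂ) + 1 - 1) / (Complex.exp t - 1) *
        multiPolylogTerm k (1 - Complex.exp (-(t : ℂ))) m := by
    intro m t ht
    obtain ⟨M, hM⟩ := Nat.exists_eq_succ_of_ne_zero m.tupleMax_pos.ne'
    rw [hz, multiPolylogTerm_ofReal, hF, add_sub_cancel_right, Complex.cpow_natCast,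
      ← Complex.ofReal_exp]
    norm_cast
    beta_reduce
    rw [hM]
    have he : Real.exp t - 1 ≠ 0 := by
      have := Real.add_one_lt_exp ht.ne'
      have : 0 < Real.exp t - 1 := by linarith
      exact this.ne'
    -- This trades one power of `1 - e^{-t}` for `e^{-t}`, hence the exponent `tupleMax m.1 - 1` in
    -- `F`; it does not truncate because the maximum is positive.
    have he' : Real.exp (-t) * (Real.exp t - 1) = 1 - Real.exp (-t) := by
      rw [mul_sub, ← Real.exp_add]; simp
    rw [Nat.succ_eq_add_one, Nat.add_sub_cancel, pow_succ (1 - Real.exp (-t)), ← he',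
      div_mul_eq_mul_div, eq_div_iff he]
    ring
  have hFs : ∀ t : ℝ, 0 < t → Summable fun m => (F m t : ℂ) := by
    intro t ht
    simp only [hFc _ t ht]
    exact (hLi t ht).mul_left _
  have hxi : ∀ t ∈ Ioi (0 : ℝ), ∑' m, (F m t : ℂ) = xiIntegrand k ((q : ℂ) + 1) t := by
    intro t ht
    rw [xiIntegrand, multiPolylog, ← tsum_mul_left]
    exact tsum_congr fun m => hFc m t ht
  have hint : ∀ m, Integrable (fun t => (F m t : ℂ)) (volume.restrict (Ioi 0)) := fun m =>
    ((integrableOn_pow_mul_exp_neg_mul q (tupleMax m.1 - 1)).const_mul _).ofReal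
  have hval : ∀ m, ∫ t in Ioi (0 : ℝ), F m t = q.factorial * xiTerm k q m := by
    intro m
    obtain ⟨M, hM⟩ := Nat.exists_eq_succ_of_ne_zero m.tupleMax_pos.ne'
    rw [hF, integral_const_mul, xiTerm, hM, Nat.succ_eq_add_one, Nat.add_sub_cancel]
    have h := integral_pow_mul_exp_neg_mul q M
    have hM' : (M : ℝ) + 1 ≠ 0 := by positivity
    push_cast
    rw [mul_comm, ← eq_div_iff hM'] at h
    rw [h]
    ring
  have hnorm : ∀ m, ∫ t in Ioi (0 : ℝ), ‖(F m t : ℂ)‖ = q.factorial * xiTerm k q m := by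
    intro m
    rw [← hval]
    refine setIntegral_congr_fun measurableSet_Ioi (fun t ht => ?_)
    have ht' : (0 : ℝ) < t := ht
    obtain ⟨h0, h1⟩ := one_sub_exp_neg_mem ht'
    have : 0 ≤ F m t := by rw [hF]; positivity
    simp only [Complex.norm_real, Real.norm_of_nonneg this]
  have hsum : Summable fun m => ∫ t in Ioi (0 : ℝ), ‖(F m t : ℂ)‖ := by
    simp only [hnorm]
    exact (summable_xiTerm hk q).mul_left _
  refine ⟨⟨hLi, ?_⟩, ?_⟩
  · have := integrable_tsum_of_summable_integral_norm hint hsum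
      (by filter_upwards [ae_restrict_mem measurableSet_Ioi] with t ht using hFs t ht)
    exact IntegrableOn.congr_fun this hxi measurableSet_Ioi
  · have h1 := (hasSum_integral_of_summable_integral_norm hint hsum).tsum_eq
    rw [arakawaKanekoXi, ← setIntegral_congr_fun measurableSet_Ioi hxi, ← h1,
      Complex.Gamma_nat_eq_factorial]
    have h2 : ∀ m, ∫ t in Ioi (0 : ℝ), (F m t : ℂ) = ((q.factorial * xiTerm k q m : ℝ) : ℂ) :=
      fun m => by rw [← hval]; exact integral_ofReal
    simp only [h2]
    rw [← Complex.ofReal_tsum, tsum_mul_left]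
    push_cast
    have : (q.factorial : ℂ) ≠ 0 := by exact_mod_cast q.factorial_ne_zero
    field_simp

/-- The last exponent exceeds 1 by at least one; half a power of the largest entry already suffices
for `summable_prod_inv_div_sqrt`. -/
theorem summable_zetaStarTerm {r : ℕ} [NeZero r] {k : Fin r → ℕ} (hk : IsAdmissible k) :
    Summable (zetaStarTerm k) := by
  have hs : Summable fun m : WeakTuple r =>
      (∏ i, 1 / (m.1 i : ℝ)) * (1 / Real.sqrt (tupleMax m.1)) :=
    summable_prod_inv_div_sqrt (NeZero.ne r) (m := fun m : WeakTuple r => m.1)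
      Subtype.val_injective (fun m i => m.2.1 i) (fun m i => le_tupleMax m.1 i)
  refine Summable.of_nonneg_of_le (fun m => by rw [zetaStarTerm]; positivity) (fun m => ?_) hs
  have hM : tupleMax m.1 = m.1 (lastPos r) := tupleMax_eq m.2.2
  have h1 : (1 : ℝ) ≤ m.1 (lastPos r) := by exact_mod_cast m.2.1 _
  have h2 : ∏ i, 1 / (m.1 i : ℝ) ^ k i ≤ ∏ i, (1 / (m.1 i : ℝ)) *
      (if i = lastPos r then 1 / Real.sqrt (m.1 i) else 1) := by
    refine Finset.prod_le_prod (fun i _ => by positivity) (fun i _ => ?_)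
    split_ifs with h
    · subst h
      rw [one_div_mul_one_div]
      refine one_div_le_one_div_of_le (mul_pos (by linarith) (Real.sqrt_pos.2 (by linarith))) ?_
      have h3 : Real.sqrt (m.1 (lastPos r)) ≤ m.1 (lastPos r) := by
        rw [Real.sqrt_le_left (by linarith)]
        nlinarith
      calc (m.1 (lastPos r) : ℝ) * Real.sqrt (m.1 (lastPos r)) ≤
            (m.1 (lastPos r) : ℝ) * m.1 (lastPos r) := by gcongr
        _ = (m.1 (lastPos r) : ℝ) ^ 2 := (sq _).symm
        _ ≤ _ := pow_le_pow_right₀ h1 hk.2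
    · rw [mul_one]
      exact inv_pow_le_inv (m.2.1 i) (hk.1 i)
  rw [Finset.prod_mul_distrib, Finset.prod_ite_eq' Finset.univ (lastPos r)] at h2
  simpa [zetaStarTerm, hM, Finset.prod_inv_distrib] using h2

/-! ### The connector and summation over strictly increasing tuples. -/

theorem tupleMax_snoc {r : ℕ} {m : Fin r → ℕ} {M : ℕ} (h : tupleMax m ≤ M) :
    tupleMax (Fin.snoc (α := fun _ => ℕ) m M : Fin (r + 1) → ℕ) = M := by
  refine le_antisymm (Finset.sup_le fun i _ => ?_) ?_
  · refine Fin.lastCases ?_ (fun i => ?_) i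
    · simp
    · simpa using (le_tupleMax m i).trans h
  · simpa using le_tupleMax (Fin.snoc (α := fun _ => ℕ) m M : Fin (r + 1) → ℕ) (Fin.last r)

/-- A strictly increasing tuple is one that is shorter by an entry, followed by a larger entry. -/
def strictTupleSnocEquiv (r : ℕ) : StrictTuple r × ℕ ≃ StrictTuple (r + 1) where
  toFun p := ⟨Fin.snoc (α := fun _ => ℕ) p.1.1 (tupleMax p.1.1 + 1 + p.2), by
    constructor
    · intro i
      refine Fin.lastCases ?_ (fun i => ?_) i
      · simp only [Fin.snoc_last]; omega
      · simpa only [Fin.snoc_castSucc] using p.1.2.1 i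
    · intro i j
      refine Fin.lastCases (fun h => ?_) (fun j => ?_) j
      · refine Fin.lastCases (fun h => ?_) (fun i _ => ?_) i h
        · exact absurd h (lt_irrefl _)
        · simp only [Fin.snoc_last, Fin.snoc_castSucc]
          have := le_tupleMax p.1.1 i
          omega
      · refine Fin.lastCases (fun h => ?_) (fun i h => ?_) i
        · exact absurd h (Fin.castSucc_lt_last j).not_gt
        · simp only [Fin.snoc_castSucc]
          exact p.1.2.2 (Fin.castSucc_lt_castSucc_iff.1 h)⟩
  invFun m := (⟨fun i => m.1 i.castSucc, fun i => m.2.1 _, fun _ _ h =>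
      m.2.2 (Fin.castSucc_lt_castSucc_iff.2 h)⟩,
    m.1 (Fin.last r) - (tupleMax (fun i : Fin r => m.1 i.castSucc) + 1))
  left_inv p := by
    ext
    · simp
    · simp
  right_inv m := by
    have h : tupleMax (fun i : Fin r => m.1 i.castSucc) + 1 ≤ m.1 (Fin.last r) := by
      have : tupleMax (fun i : Fin r => m.1 i.castSucc) < m.1 (Fin.last r) := by
        rw [tupleMax, Finset.sup_lt_iff (m.2.1 _)]
        exact fun i _ => m.2.2 (Fin.castSucc_lt_last i)
      omega
    ext i
    refine Fin.lastCases ?_ (fun i => ?_) i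
    · simp only [Fin.snoc_last]; omega
    · simp only [Fin.snoc_castSucc]

theorem tupleMax_strictTupleSnocEquiv {r : ℕ} (m : StrictTuple r) (j : ℕ) :
    tupleMax (strictTupleSnocEquiv r (m, j)).1 = tupleMax m.1 + 1 + j :=
  tupleMax_snoc (by omega)

theorem prod_strictTupleSnocEquiv {r : ℕ} (f : ℕ → ℝ) (m : StrictTuple r) (j : ℕ) :
    ∏ i, f ((strictTupleSnocEquiv r (m, j)).1 i) = (∏ i, f (m.1 i)) * f (tupleMax m.1 + 1 + j) := by
  rw [Fin.prod_univ_castSucc]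
  simp [strictTupleSnocEquiv]

/-- The connector of the connected sum that relates the two sides of the sum formula. -/
noncomputable def connector (x N : ℝ) (M : ℕ) : ℝ :=
  ∏ j ∈ Finset.range M, ((j : ℝ) + 1 - x) / (j + 1 + N)

theorem connector_nonneg {x N : ℝ} (hx : x < 1) (hN : 0 ≤ N) (M : ℕ) : 0 ≤ connector x N M := by
  refine Finset.prod_nonneg fun j _ => div_nonneg ?_ (by positivity)
  have : (0 : ℝ) ≤ j := Nat.cast_nonneg j
  linarith

/-- The extreme case is `x = 0`, `N = 1`, where the product telescopes. The bound makes the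
connector tend to 0, as telescoping requires. -/
theorem connector_le {x N : ℝ} (h0 : 0 ≤ x) (h1 : x < 1) (hN : 1 ≤ N) (M : ℕ) :
    connector x N M ≤ 1 / ((M : ℝ) + 1) := by
  induction M with
  | zero => simp [connector]
  | succ M ih =>
    have hM : (0 : ℝ) ≤ M := Nat.cast_nonneg M
    have e : connector x N (M + 1) = connector x N M * (((M : ℝ) + 1 - x) / (M + 1 + N)) :=
      Finset.prod_range_succ _ _
    have h2 : ((M : ℝ) + 1 - x) / (M + 1 + N) ≤ (M + 1) / (M + 2) := by
      rw [div_le_div_iff₀ (by linarith) (by linarith)]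
      nlinarith
    rw [e]
    calc _ ≤ 1 / ((M : ℝ) + 1) * ((M + 1) / (M + 2)) :=
          mul_le_mul ih h2 (div_nonneg (by linarith) (by linarith)) (by positivity)
      _ = _ := by push_cast; field_simp; ring

/-- With `n = M + 1 + j`, the term is `c(n - 1)/(n + N)`, and `1 - (n - x)/(n + N) = (N + x)/(n +
N)` makes it the difference of consecutive values of `c/(N + x)`. -/
theorem hasSum_connector {x N : ℝ} (h0 : 0 ≤ x) (h1 : x < 1) (hN : 1 ≤ N) (M : ℕ) :
    HasSum (fun j : ℕ => 1 / (((M + 1 + j : ℕ) : ℝ) - x) * connector x N (M + 1 + j))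
      (connector x N M / (N + x)) := by
  have hlim : Tendsto (connector x N) atTop (𝓝 0) :=
    squeeze_zero (connector_nonneg h1 (by linarith)) (connector_le h0 h1 hN)
      tendsto_one_div_add_atTop_nhds_zero_nat
  have hpos : ∀ j : ℕ, 0 < ((M + 1 + j : ℕ) : ℝ) - x := fun j => by
    have : (0 : ℝ) ≤ M := Nat.cast_nonneg M
    have : (0 : ℝ) ≤ j := Nat.cast_nonneg j
    push_cast; linarith
  refine hasSum_telescope (u := fun j => connector x N (M + j) / (N + x))
    (fun j => mul_nonneg (one_div_nonneg.2 (hpos j).le) (connector_nonneg h1 (by linarith) _))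
    (fun j => ?_) ?_
  · have e : connector x N (M + j + 1) =
        connector x N (M + j) * ((((M + j : ℕ) : ℝ) + 1 - x) / ((M + j : ℕ) + 1 + N)) :=
      Finset.prod_range_succ _ _
    rw [show M + 1 + j = M + j + 1 by ring, ← add_assoc, e]
    have h2 := (hpos j).ne'
    rw [show M + 1 + j = M + j + 1 by ring] at h2
    have h3 : ((M + j : ℕ) : ℝ) + 1 + N ≠ 0 := by positivity
    have h4 : N + x ≠ 0 := by positivity
    push_cast at h2 h3 ⊢
    field_simp
    ring
  · have := (hlim.comp (tendsto_add_atTop_nat M)).div_const (N + x)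
    rw [zero_div] at this
    refine this.congr fun j => ?_
    simp [add_comm]

/-- Summing out the largest entry reproduces the connector at the next largest one with a factor
`1/(N + x)`; this happens `r` times. -/
theorem hasSum_strictTuple_connector {x N : ℝ} (h0 : 0 ≤ x) (h1 : x < 1) (hN : 1 ≤ N) (r : ℕ) :
    HasSum (fun m : StrictTuple r => (∏ i, 1 / ((m.1 i : ℝ) - x)) * connector x N (tupleMax m.1))
      (1 / (N + x) ^ r) := by
  induction r with
  | zero =>
    have : Unique (StrictTuple 0) :=
      ⟨⟨⟨Fin.elim0, fun i => i.elim0, fun i => i.elim0⟩⟩, fun m => Subtype.ext (Subsingleton.elim _ _)⟩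
    simp [tupleMax, connector]
  | succ r ih =>
    rw [← (strictTupleSnocEquiv r).hasSum_iff]
    refine HasSum.prod_of_nonneg (g := fun m : StrictTuple r =>
      (∏ i, 1 / ((m.1 i : ℝ) - x)) * connector x N (tupleMax m.1) * (1 / (N + x)))
      (fun p => ?_) (fun m => ?_) ?_
    · refine mul_nonneg (Finset.prod_nonneg fun i _ => one_div_nonneg.2 ?_)
        (connector_nonneg h1 (by linarith) _)
      have : (1 : ℝ) ≤ ((strictTupleSnocEquiv r p).1 i : ℝ) := by
        exact_mod_cast (strictTupleSnocEquiv r p).2.1 i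
      linarith
    · have := (hasSum_connector h0 h1 hN (tupleMax m.1)).mul_left (∏ i, 1 / ((m.1 i : ℝ) - x))
      convert! this using 1
      · funext j
        simp only [Function.comp]
        rw [tupleMax_strictTupleSnocEquiv,
          prod_strictTupleSnocEquiv (fun n : ℕ => 1 / ((n : ℝ) - x))]
        ring
      · ring
    · convert! ih.mul_right (1 / (N + x)) using 1
      rw [pow_succ]
      field_simp

/-! ### Weakly increasing tuples and tails of zeta-star values. -/

/-- The tuples `n ≤ m₁ ≤ ⋯ ≤ m_b`. -/
abbrev WeakTupleFrom (n b : ℕ) : Type := {m : Fin b → ℕ // (∀ i, n ≤ m i) ∧ Monotone m}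

/-- A weakly increasing tuple is its first entry, followed by a tuple from that entry on. -/
def weakTupleConsEquiv (n b : ℕ) : (Σ j : ℕ, WeakTupleFrom (n + j) b) ≃ WeakTupleFrom n (b + 1) where
  toFun p := ⟨Fin.cons (α := fun _ => ℕ) (n + p.1) p.2.1, by
    constructor
    · intro i
      refine Fin.cases ?_ (fun i => ?_) i
      · simp
      · have := p.2.2.1 i
        simp only [Fin.cons_succ]; omega
    · intro i j
      refine Fin.cases (fun _ => ?_) (fun i => ?_) i
      · refine Fin.cases ?_ (fun j => ?_) j
        · simp
        · simpa using p.2.2.1 j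
      · refine Fin.cases (fun h => ?_) (fun j h => ?_) j
        · exact absurd h (Fin.succ_pos i).not_ge
        · simpa using p.2.2.2 (Fin.succ_le_succ_iff.1 h)⟩
  invFun m := ⟨m.1 0 - n, fun i => m.1 i.succ, fun i => by
    have h1 := m.2.1 0
    have h2 : m.1 0 ≤ m.1 i.succ := m.2.2 (Fin.zero_le _)
    simp only; omega, fun _ _ h => m.2.2 (Fin.succ_le_succ_iff.2 h)⟩
  left_inv p := by
    obtain ⟨j, m⟩ := p
    refine Sigma.ext (by simp) ?_
    have e : n + j - n = j := by omega
    simp only [Fin.cons_succ]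
    congr!
  right_inv m := by
    have h := m.2.1 0
    ext i
    refine Fin.cases ?_ (fun i => ?_) i
    · simp only [Fin.cons_zero]; omega
    · simp only [Fin.cons_succ]

/-- The sum of `1 / (m₁² ⋯ m_b²)` over `n ≤ m₁ ≤ ⋯ ≤ m_b`. -/
noncomputable def starTail : ℕ → ℕ → ℝ
  | 0, _ => 1
  | b + 1, n => ∑' j : ℕ, starTail b (n + j) / ((n + j : ℕ) : ℝ) ^ 2

theorem hasSum_inv_mul_succ {n : ℕ} (hn : 0 < n) :
    HasSum (fun j : ℕ => 1 / (((n + j : ℕ) : ℝ) * (n + j + 1 : ℕ))) (1 / n) := by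
  have hn' : (0 : ℝ) < n := by exact_mod_cast hn
  have h := hasSum_telescope (u := fun j : ℕ => 1 / ((n + j : ℕ) : ℝ))
    (v := fun j : ℕ => 1 / (((n + j : ℕ) : ℝ) * (n + j + 1 : ℕ)))
    (fun j => by positivity) (fun j => by push_cast; field_simp; ring) ?_
  · simpa using h
  · have := (tendsto_one_div_atTop_nhds_zero_nat (𝕜 := ℝ)).comp (tendsto_add_atTop_nat n)
    refine this.congr fun j => ?_
    simp [add_comm]

theorem inv_sq_le {k : ℕ} (hk : 0 < k) :
    1 / (k : ℝ) ^ 2 ≤ 2 * (1 / ((k : ℝ) * (k + 1 : ℕ))) := by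
  have : (1 : ℝ) ≤ k := by exact_mod_cast hk
  rw [mul_one_div, div_le_div_iff₀ (by positivity) (by positivity)]
  push_cast
  nlinarith

theorem summable_inv_sq {n : ℕ} (hn : 0 < n) :
    Summable (fun j : ℕ => 1 / ((n + j : ℕ) : ℝ) ^ 2) :=
  Summable.of_nonneg_of_le (fun j => by positivity) (fun j => inv_sq_le (by omega))
    ((hasSum_inv_mul_succ hn).summable.mul_left 2)

theorem tsum_inv_sq_le {n : ℕ} (hn : 0 < n) : ∑' j : ℕ, 1 / ((n + j : ℕ) : ℝ) ^ 2 ≤ 2 / (n : ℝ) := by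
  have h := (hasSum_inv_mul_succ hn).mul_left 2
  have := (summable_inv_sq hn).tsum_le_tsum (fun j => inv_sq_le (by omega)) h.summable
  rw [h.tsum_eq] at this
  rwa [mul_one_div] at this

theorem starTail_nonneg (b n : ℕ) : 0 ≤ starTail b n := by
  induction b generalizing n with
  | zero => rw [starTail]; exact zero_le_one
  | succ b ih => rw [starTail]; exact tsum_nonneg fun j => div_nonneg (ih _) (by positivity)

theorem starTail_term_le {b : ℕ} (h : ∀ n, 0 < n → starTail b n ≤ (2 / (n : ℝ)) ^ b) {n : ℕ}
    (hn : 0 < n) (j : ℕ) : starTail b (n + j) / ((n + j : ℕ) : ℝ) ^ 2 ≤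
      (2 / (n : ℝ)) ^ b * (1 / ((n + j : ℕ) : ℝ) ^ 2) := by
  have hn' : (0 : ℝ) < n := by exact_mod_cast hn
  rw [div_eq_mul_one_div]
  refine mul_le_mul_of_nonneg_right ((h (n + j) (by omega)).trans ?_) (by positivity)
  gcongr
  omega

theorem starTail_le (b : ℕ) {n : ℕ} (hn : 0 < n) : starTail b n ≤ (2 / (n : ℝ)) ^ b := by
  induction b generalizing n with
  | zero => simp [starTail]
  | succ b ih =>
    have hs := (summable_inv_sq hn).mul_left ((2 / (n : ℝ)) ^ b)
    have hle := starTail_term_le (fun n => ih (n := n)) hn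
    have h0 : ∀ j, 0 ≤ starTail b (n + j) / ((n + j : ℕ) : ℝ) ^ 2 :=
      fun j => div_nonneg (starTail_nonneg _ _) (by positivity)
    rw [starTail, pow_succ]
    calc _ ≤ ∑' j : ℕ, (2 / (n : ℝ)) ^ b * (1 / ((n + j : ℕ) : ℝ) ^ 2) :=
          (Summable.of_nonneg_of_le h0 hle hs).tsum_le_tsum hle hs
      _ = (2 / (n : ℝ)) ^ b * ∑' j : ℕ, 1 / ((n + j : ℕ) : ℝ) ^ 2 := tsum_mul_left
      _ ≤ _ := by gcongr; exact tsum_inv_sq_le hn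

theorem hasSum_starTail (b : ℕ) {n : ℕ} (hn : 0 < n) :
    HasSum (fun j : ℕ => starTail b (n + j) / ((n + j : ℕ) : ℝ) ^ 2) (starTail (b + 1) n) := by
  rw [starTail]
  exact (Summable.of_nonneg_of_le (fun j => div_nonneg (starTail_nonneg _ _) (by positivity))
    (starTail_term_le (fun n => starTail_le b (n := n)) hn)
    ((summable_inv_sq hn).mul_left _)).hasSum

/-- Splits the tuples by whether the first entry equals `n`. -/
theorem starTail_succ (b : ℕ) {n : ℕ} (hn : 0 < n) :
    starTail (b + 1) n = starTail b n / (n : ℝ) ^ 2 + starTail (b + 1) (n + 1) := by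
  have h := (hasSum_nat_add_iff' 1).2 (hasSum_starTail b hn)
  have h2 := (hasSum_starTail b (n := n + 1) (by omega)).unique (h.congr_of_eq fun j => by
    rw [show n + 1 + j = n + (j + 1) by ring])
  rw [h2]
  simp

theorem hasSum_weakTupleFrom (b : ℕ) {n : ℕ} (hn : 0 < n) :
    HasSum (fun m : WeakTupleFrom n b => 1 / ∏ i, (m.1 i : ℝ) ^ 2) (starTail b n) := by
  induction b generalizing n with
  | zero =>
    have : Unique (WeakTupleFrom n 0) :=
      ⟨⟨⟨Fin.elim0, fun i => i.elim0, fun i => i.elim0⟩⟩, fun m => Subtype.ext (Subsingleton.elim _ _)⟩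
    simp [starTail]
  | succ b ih =>
    rw [← (weakTupleConsEquiv n b).hasSum_iff]
    refine HasSum.sigma_of_nonneg (fun p => by simp only [Function.comp]; positivity)
      (fun j => ?_) (hasSum_starTail b hn)
    refine ((ih (n := n + j) (by omega)).div_const (((n + j : ℕ) : ℝ) ^ 2)).congr_of_eq fun m => ?_
    simp only [Function.comp, Fin.prod_univ_succ]
    simp [weakTupleConsEquiv, mul_comm, div_eq_mul_inv]

theorem hasSum_zetaStar {c : ℕ} (hc : 2 ≤ c) (b : ℕ) :
    HasSum (fun j : ℕ => starTail b (j + 1) / ((j : ℝ) + 1) ^ c)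
      (zetaStar (Fin.cons (α := fun _ => ℕ) c (fun _ : Fin b => 2) : Fin (b + 1) → ℕ)) := by
  have hadm : IsAdmissible (Fin.cons (α := fun _ => ℕ) c (fun _ : Fin b => 2) : Fin (b + 1) → ℕ) := by
    have : ∀ i, 2 ≤ (Fin.cons (α := fun _ => ℕ) c (fun _ : Fin b => 2) : Fin (b + 1) → ℕ) i :=
      fun i => Fin.cases (by simpa using hc) (fun i => by simp) i
    exact ⟨fun i => one_le_two.trans (this i), this _⟩
  have h := (summable_zetaStarTerm hadm).hasSum
  change HasSum _ (zetaStar _) at h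
  have h2 := ((weakTupleConsEquiv 1 b).hasSum_iff (f := fun m : WeakTuple (b + 1) =>
    zetaStarTerm (Fin.cons (α := fun _ => ℕ) c (fun _ : Fin b => 2) : Fin (b + 1) → ℕ) m)).2 h
  refine h2.sigma fun j => ?_
  rw [show j + 1 = 1 + j by ring]
  refine ((hasSum_weakTupleFrom b (n := 1 + j) (by omega)).div_const
    (((j : ℝ) + 1) ^ c)).congr_of_eq fun m => ?_
  simp only [Function.comp, zetaStarTerm, Fin.prod_univ_succ]
  simp [weakTupleConsEquiv, mul_comm, div_eq_mul_inv, add_comm]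

/-- The generating function of `starTail · n`, that is `∏ m ≥ n, (1 - x² / m²)⁻¹`. -/
noncomputable def starTailGen (x : ℝ) (n : ℕ) : ℝ := ∑' b, x ^ (2 * b) * starTail b n

theorem starTailGen_term_le {x : ℝ} (h0 : 0 ≤ x) (h1 : x ≤ 1 / 2) {n : ℕ} (hn : 0 < n) (b : ℕ) :
    x ^ (2 * b) * starTail b n ≤ (1 / (2 * (n : ℝ))) ^ b := by
  have hn' : (0 : ℝ) < n := by exact_mod_cast hn
  calc x ^ (2 * b) * starTail b n ≤ (1 / 2) ^ (2 * b) * (2 / (n : ℝ)) ^ b := by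
        gcongr
        exacts [starTail_nonneg _ _, starTail_le b hn]
    _ = _ := by
        rw [pow_mul, ← mul_pow]
        congr 1
        field_simp

theorem inv_two_mul_le_half {n : ℕ} (hn : 0 < n) : 1 / (2 * (n : ℝ)) ≤ 1 / 2 := by
  have : (1 : ℝ) ≤ n := by exact_mod_cast hn
  exact one_div_le_one_div_of_le (by norm_num) (by linarith)

theorem hasSum_starTailGen {x : ℝ} (h0 : 0 ≤ x) (h1 : x ≤ 1 / 2) {n : ℕ} (hn : 0 < n) :
    HasSum (fun b => x ^ (2 * b) * starTail b n) (starTailGen x n) :=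
  (Summable.of_nonneg_of_le (fun b => mul_nonneg (by positivity) (starTail_nonneg _ _))
    (starTailGen_term_le h0 h1 hn)
    (summable_geometric_of_lt_one (by positivity) (by linarith [inv_two_mul_le_half hn]))).hasSum

theorem one_le_starTailGen {x : ℝ} (h0 : 0 ≤ x) (h1 : x ≤ 1 / 2) {n : ℕ} (hn : 0 < n) :
    1 ≤ starTailGen x n := by
  have h := (hasSum_starTailGen h0 h1 hn).summable.le_tsum 0
    (fun b _ => mul_nonneg (by positivity) (starTail_nonneg _ _))
  rw [starTailGen]
  simpa [starTail] using h

theorem starTailGen_le {x : ℝ} (h0 : 0 ≤ x) (h1 : x ≤ 1 / 2) {n : ℕ} (hn : 0 < n) :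
    starTailGen x n ≤ (1 - 1 / (2 * (n : ℝ)))⁻¹ := by
  have hlt : 1 / (2 * (n : ℝ)) < 1 := by linarith [inv_two_mul_le_half hn]
  exact hasSum_le (starTailGen_term_le h0 h1 hn) (hasSum_starTailGen h0 h1 hn)
    (hasSum_geometric_of_lt_one (by positivity) hlt)

theorem starTailGen_le_two {x : ℝ} (h0 : 0 ≤ x) (h1 : x ≤ 1 / 2) {n : ℕ} (hn : 0 < n) :
    starTailGen x n ≤ 2 := by
  refine (starTailGen_le h0 h1 hn).trans ?_
  have := inv_two_mul_le_half hn
  rw [inv_le_comm₀ (by linarith) (by norm_num)]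
  linarith

/-- Multiplying `starTail_succ` by `x^{2(b+1)}` and summing over `b` removes the factor at `n` from
the infinite product. -/
theorem starTailGen_succ {x : ℝ} (h0 : 0 ≤ x) (h1 : x ≤ 1 / 2) {n : ℕ} (hn : 0 < n) :
    starTailGen x (n + 1) = starTailGen x n * (1 - x ^ 2 / (n : ℝ) ^ 2) := by
  have h2 := (hasSum_nat_add_iff' 1).2 (hasSum_starTailGen h0 h1 hn)
  have h3 := (hasSum_nat_add_iff' 1).2 (hasSum_starTailGen h0 h1 (n := n + 1) (by omega))
  have h4 := ((hasSum_starTailGen h0 h1 hn).mul_left (x ^ 2 / (n : ℝ) ^ 2)).add h3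
  have h5 := h2.unique (h4.congr_of_eq fun b => by
    rw [starTail_succ b hn, mul_add, mul_add, pow_add]
    ring)
  simp only [Finset.sum_range_one, mul_zero, pow_zero, one_mul, starTail] at h5
  linarith

theorem tendsto_starTailGen {x : ℝ} (h0 : 0 ≤ x) (h1 : x ≤ 1 / 2) :
    Tendsto (fun i : ℕ => starTailGen x (i + 1)) atTop (𝓝 1) := by
  have hlim : Tendsto (fun i : ℕ => (1 - 1 / 2 * (1 / ((i : ℝ) + 1)))⁻¹) atTop (𝓝 1) := by
    have := ((tendsto_one_div_add_atTop_nhds_zero_nat (𝕜 := ℝ)).const_mul (1 / 2)).const_sub 1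
    simpa using this.inv₀ (by norm_num)
  refine tendsto_of_tendsto_of_tendsto_of_le_of_le tendsto_const_nhds hlim
    (fun i => one_le_starTailGen h0 h1 (by omega)) (fun i => ?_)
  have := starTailGen_le h0 h1 (n := i + 1) (by omega)
  convert! this using 3
  push_cast
  field_simp

/-! ### A Gauss summation by recursion on the number of factors. -/

/-- `1 / ((i + 1) ⋯ (i + M + 1))`. -/
noncomputable def invRising (M i : ℕ) : ℝ := 1 / ∏ l ∈ Finset.range (M + 1), ((i : ℝ) + 1 + l)

theorem invRising_nonneg (M i : ℕ) : 0 ≤ invRising M i := by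
  rw [invRising]; positivity

theorem invRising_succ_left (M i : ℕ) : invRising (M + 1) i = invRising M i / (i + M + 2) := by
  rw [invRising, invRising, Finset.prod_range_succ _ (M + 1), div_div]
  push_cast
  congr 2
  ring

theorem invRising_succ_right (M i : ℕ) :
    invRising M (i + 1) = invRising M i * (i + 1) / (i + M + 2) := by
  have h := Finset.prod_range_succ (fun l : ℕ => (i : ℝ) + 1 + l) (M + 1)
  rw [Finset.prod_range_succ'] at h
  have e : ∏ l ∈ Finset.range (M + 1), (((i + 1 : ℕ) : ℝ) + 1 + l) =
      ∏ l ∈ Finset.range (M + 1), ((i : ℝ) + 1 + ((l + 1 : ℕ) : ℝ)) :=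
    Finset.prod_congr rfl fun l _ => by push_cast; ring
  rw [← e] at h
  have p1 : ∏ l ∈ Finset.range (M + 1), (((i + 1 : ℕ) : ℝ) + 1 + l) ≠ 0 := by positivity
  have p2 : ∏ l ∈ Finset.range (M + 1), ((i : ℝ) + 1 + l) ≠ 0 := by positivity
  have p3 : (i : ℝ) + M + 2 ≠ 0 := by positivity
  rw [invRising, invRising]
  push_cast at h p1 ⊢
  field_simp
  linear_combination -h

theorem invRising_le (M i : ℕ) : invRising M i ≤ 1 / ((i : ℝ) + 1) := by
  induction M with
  | zero => simp [invRising]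
  | succ M ih =>
    rw [invRising_succ_left]
    refine (div_le_self (invRising_nonneg M i) ?_).trans ih
    have : (0 : ℝ) ≤ i := Nat.cast_nonneg i
    have : (0 : ℝ) ≤ M := Nat.cast_nonneg M
    linarith

/-- A case of the Gauss summation formula. -/
theorem hasSum_invRising_mul_starTailGen {x : ℝ} (h0 : 0 ≤ x) (h1 : x ≤ 1 / 2) (M : ℕ) :
    HasSum (fun i => invRising (M + 1) i * starTailGen x (i + 1))
      (M.factorial / ∏ k ∈ Finset.range (M + 1), (((k : ℝ) + 1) ^ 2 - x ^ 2)) := by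
  have hQ : ∀ i : ℕ, 1 ≤ starTailGen x (i + 1) := fun i => one_le_starTailGen h0 h1 (by omega)
  have hnn : ∀ M i, 0 ≤ invRising M i * starTailGen x (i + 1) := fun M i =>
    mul_nonneg (invRising_nonneg M i) (by linarith [hQ i])
  have hpos : ∀ k : ℕ, 0 < ((k : ℝ) + 1) ^ 2 - x ^ 2 := fun k => by
    have : (0 : ℝ) ≤ k := Nat.cast_nonneg k
    nlinarith
  -- A contiguous relation: up to a difference in `i`, the summand for `M + 1` is a multiple of the
  -- one for `M`. Summing over `i` leaves only the boundary limit `B`.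
  have key : ∀ M i : ℕ, (((M : ℝ) + 1) ^ 2 - x ^ 2) * (invRising (M + 1) i * starTailGen x (i + 1)) =
      M * (invRising M i * starTailGen x (i + 1)) +
        (((i + 1 : ℕ) : ℝ) * invRising M (i + 1) * starTailGen x (i + 1 + 1) -
          i * invRising M i * starTailGen x (i + 1)) := by
    intro M i
    rw [starTailGen_succ h0 h1 (n := i + 1) (by omega), invRising_succ_left, invRising_succ_right]
    push_cast
    field_simp
    ring
  have step : ∀ (M : ℕ) (S B : ℝ), HasSum (fun i => M * (invRising M i * starTailGen x (i + 1))) S →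
      Tendsto (fun i : ℕ => i * invRising M i * starTailGen x (i + 1)) atTop (𝓝 B) →
      HasSum (fun i => invRising (M + 1) i * starTailGen x (i + 1))
        ((S + B) / (((M : ℝ) + 1) ^ 2 - x ^ 2)) := by
    intro M S B hS hB
    rw [hasSum_iff_tendsto_nat_of_nonneg (hnn _)]
    refine ((hS.tendsto_sum_nat.add hB).div_const (((M : ℝ) + 1) ^ 2 - x ^ 2)).congr fun n => ?_
    rw [div_eq_iff (hpos M).ne', mul_comm _ (((M : ℝ) + 1) ^ 2 - x ^ 2), Finset.mul_sum]
    simp only [key M, Finset.sum_add_distrib]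
    rw [Finset.sum_range_sub (fun i : ℕ => (i : ℝ) * invRising M i * starTailGen x (i + 1))]
    simp
  induction M with
  | zero =>
    have hB : Tendsto (fun i : ℕ => i * invRising 0 i * starTailGen x (i + 1)) atTop (𝓝 1) := by
      have h2 : Tendsto (fun i : ℕ => 1 - 1 / ((i : ℝ) + 1)) atTop (𝓝 1) := by
        simpa using (tendsto_one_div_add_atTop_nhds_zero_nat (𝕜 := ℝ)).const_sub 1
      have h3 := h2.mul (tendsto_starTailGen h0 h1)
      rw [mul_one] at h3
      refine h3.congr fun i => ?_
      have : (i : ℝ) + 1 ≠ 0 := by positivity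
      simp only [invRising, zero_add, Finset.prod_range_one, Nat.cast_zero, add_zero]
      field_simp
      ring
    -- For `M = 0` the factor `M` annihilates a series that would diverge, and the value comes
    -- entirely from the boundary limit 1.
    convert! step 0 0 1 (by simp) hB using 1
    simp
  | succ M ih =>
    have hB : Tendsto (fun i : ℕ => i * invRising (M + 1) i * starTailGen x (i + 1)) atTop (𝓝 0) := by
      have h2 : Tendsto (fun i : ℕ => 2 * (1 / ((i : ℝ) + 1))) atTop (𝓝 0) := by
        simpa using (tendsto_one_div_add_atTop_nhds_zero_nat (𝕜 := ℝ)).const_mul 2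
      refine squeeze_zero (fun i => ?_) (fun i => ?_) h2
      · rw [mul_assoc]
        exact mul_nonneg (Nat.cast_nonneg i) (hnn _ i)
      · have hM : (0 : ℝ) ≤ M := Nat.cast_nonneg M
        have hi : (0 : ℝ) ≤ i := Nat.cast_nonneg i
        have h4 : i * invRising (M + 1) i ≤ 1 / ((i : ℝ) + 1) := by
          refine le_trans ?_ (invRising_le M i)
          rw [invRising_succ_left, ← mul_div_assoc, div_le_iff₀ (by positivity)]
          nlinarith [invRising_nonneg M i]
        have h5 := starTailGen_le_two h0 h1 (n := i + 1) (by omega)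
        calc _ ≤ 1 / ((i : ℝ) + 1) * 2 :=
              mul_le_mul h4 h5 (by linarith [hQ i]) (by positivity)
          _ = _ := mul_comm _ _
    convert! step (M + 1) _ 0 (ih.mul_left _) hB using 1
    rw [Finset.prod_range_succ _ (M + 1), Nat.factorial_succ]
    push_cast
    rw [add_zero, mul_div_assoc', div_div]

/-- The numerator of the connector does not depend on `N = i + 1`, and its denominator times `N` is
a rising product, so the Gauss summation applies; then `k² - x² = (k - x)(k + x)` cancels the
numerator. -/
theorem hasSum_connector_mul_starTailGen {x : ℝ} (h0 : 0 ≤ x) (h1 : x ≤ 1 / 2) {M : ℕ} (hM : 0 < M) :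
    HasSum (fun i : ℕ => connector x (i + 1) M * (starTailGen x (i + 1) / (i + 1)))
      ((∏ j ∈ Finset.range M, ((j : ℝ) + 1) / (j + 1 + x)) / M) := by
  obtain ⟨M, rfl⟩ := Nat.exists_eq_succ_of_ne_zero hM.ne'
  have h := (hasSum_invRising_mul_starTailGen h0 h1 M).mul_left
    (∏ j ∈ Finset.range (M + 1), ((j : ℝ) + 1 - x))
  have hpos : ∀ k : ℕ, 0 < (k : ℝ) + 1 - x := fun k => by
    have : (0 : ℝ) ≤ k := Nat.cast_nonneg k
    linarith
  convert! h using 1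
  · funext i
    rw [connector, Finset.prod_div_distrib, invRising, Finset.prod_range_succ' _ (M + 1)]
    have e : ∏ l ∈ Finset.range (M + 1), ((i : ℝ) + 1 + ((l + 1 : ℕ) : ℝ)) =
        ∏ l ∈ Finset.range (M + 1), ((l : ℝ) + 1 + (i + 1)) :=
      Finset.prod_congr rfl fun l _ => by push_cast; ring
    rw [e]
    have : ∏ l ∈ Finset.range (M + 1), ((l : ℝ) + 1 + (i + 1)) ≠ 0 := by positivity
    field_simp
    push_cast
    ring
  · have e : ∏ k ∈ Finset.range (M + 1), (((k : ℝ) + 1) ^ 2 - x ^ 2) =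
        (∏ k ∈ Finset.range (M + 1), ((k : ℝ) + 1 - x)) *
          ∏ k ∈ Finset.range (M + 1), ((k : ℝ) + 1 + x) := by
      rw [← Finset.prod_mul_distrib]
      exact Finset.prod_congr rfl fun k _ => by ring
    have e2 : ∏ k ∈ Finset.range (M + 1), ((k : ℝ) + 1) = (M + 1) * M.factorial := by
      have := Finset.prod_range_add_one_eq_factorial (M + 1)
      rw [Nat.factorial_succ] at this
      exact_mod_cast this
    have p1 : ∏ k ∈ Finset.range (M + 1), ((k : ℝ) + 1 - x) ≠ 0 :=
      (Finset.prod_pos fun k _ => hpos k).ne'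
    have p2 : ∏ k ∈ Finset.range (M + 1), ((k : ℝ) + 1 + x) ≠ 0 := by positivity
    rw [e, Finset.prod_div_distrib, e2]
    push_cast
    field_simp

/-- The value of the generating function of the alternating sums of `ξ`, as a series in one
variable. -/
theorem hasSum_strictTuple_generating {x : ℝ} (h0 : 0 ≤ x) (h1 : x ≤ 1 / 2) (r : ℕ) [NeZero r] :
    HasSum (fun m : StrictTuple r => (∏ i, 1 / ((m.1 i : ℝ) - x)) *
        ((∏ j ∈ Finset.range (tupleMax m.1), ((j : ℝ) + 1) / (j + 1 + x)) / tupleMax m.1))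
      (∑' i : ℕ, starTailGen x (i + 1) / (((i : ℝ) + 1) * (i + 1 + x) ^ r)) := by
  have hx1 : x < 1 := by linarith
  have hs : Summable fun i : ℕ => starTailGen x (i + 1) / (((i : ℝ) + 1) * (i + 1 + x) ^ r) := by
    refine Summable.of_nonneg_of_le (fun i => ?_) (fun i => ?_)
      ((summable_inv_sq (n := 1) one_pos).mul_left 2)
    · exact div_nonneg (by linarith [one_le_starTailGen h0 h1 (n := i + 1) (by omega)])
        (by positivity)
    · have hi : (0 : ℝ) ≤ i := Nat.cast_nonneg i
      rw [mul_one_div]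
      refine div_le_div₀ (by norm_num) (starTailGen_le_two h0 h1 (by omega)) (by positivity) ?_
      have h3 : (i : ℝ) + 1 ≤ ((i : ℝ) + 1 + x) ^ r :=
        le_trans (by linarith) (le_self_pow₀ (by linarith) (NeZero.ne r))
      push_cast
      nlinarith
  have hpos : ∀ (m : StrictTuple r) (i : Fin r), 0 < (m.1 i : ℝ) - x := fun m i => by
    have : (1 : ℝ) ≤ m.1 i := by exact_mod_cast m.2.1 i
    linarith
  -- All terms are nonnegative, so the double series may be summed over tuples first to fix its
  -- value, then over `N` first to get the claim.
  have hprod : HasSum (fun p : ℕ × StrictTuple r => (∏ i, 1 / ((p.2.1 i : ℝ) - x)) *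
      (connector x (p.1 + 1) (tupleMax p.2.1) * (starTailGen x (p.1 + 1) / (p.1 + 1))))
      (∑' i : ℕ, starTailGen x (i + 1) / (((i : ℝ) + 1) * (i + 1 + x) ^ r)) := by
    refine HasSum.prod_of_nonneg (fun p => ?_) (fun i => ?_) hs.hasSum
    · refine mul_nonneg (Finset.prod_nonneg fun i _ => one_div_nonneg.2 (hpos _ i).le)
        (mul_nonneg (connector_nonneg hx1 (by positivity) _) (div_nonneg ?_ (by positivity)))
      linarith [one_le_starTailGen h0 h1 (n := p.1 + 1) (by omega)]
    · have := (hasSum_strictTuple_connector h0 hx1 (N := i + 1)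
        (by have : (0 : ℝ) ≤ i := Nat.cast_nonneg i
            linarith) r).mul_right (starTailGen x (i + 1) / (i + 1))
      convert! this using 1
      · funext m; ring
      · field_simp
  refine ((Equiv.prodComm (StrictTuple r) ℕ).hasSum_iff.2 hprod).prod_fiberwise fun m => ?_
  exact (hasSum_connector_mul_starTailGen h0 h1 m.tupleMax_pos).mul_left _

/-! ### Generating functions of both sides of (2). -/

/-- Grouping the terms of a series by a degree with finite fibres. -/
theorem HasSum.group_by_degree {ι : Type*} {f : ι → ℝ} {a : ℝ} (h : HasSum f a) (deg : ι → ℕ)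
    (s : ℕ → Finset ι) (hs : ∀ k i, i ∈ s k ↔ deg i = k) :
    HasSum (fun k => ∑ i ∈ s k, f i) a := by
  refine HasSum.sigma ((Equiv.sigmaFiberEquiv deg).hasSum_iff.2 h) fun k => ?_
  have h1 := (s k).hasSum f
  exact (Equiv.subtypeEquivRight (hs k)).symm.hasSum_iff.2 h1

theorem hasSum_geometric_inv {x m : ℝ} (hm : |x| < m) :
    HasSum (fun j : ℕ => x ^ j * (1 / m ^ (j + 1))) (1 / (m - x)) := by
  have hm0 : 0 < m := (abs_nonneg x).trans_lt hm
  have hlt : ‖x / m‖ < 1 := by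
    rw [norm_div, Real.norm_eq_abs, Real.norm_of_nonneg hm0.le, div_lt_one hm0]; exact hm
  have h := (hasSum_geometric_of_norm_lt_one hlt).mul_right (1 / m)
  have hne : m - x ≠ 0 := by
    have := (le_abs_self x).trans_lt hm
    linarith
  convert! h using 1
  · funext j
    rw [div_pow, pow_succ]
    field_simp
  · have : 1 - x / m ≠ 0 := by
      rw [one_sub_div hm0.ne']
      exact div_ne_zero hne hm0.ne'
    field_simp

theorem prod_one_div_sub_le {x : ℝ} (h1 : x ≤ 1 / 2) {r : ℕ} (m : StrictTuple r) :
    ∏ i, 1 / ((m.1 i : ℝ) - x) ≤ 2 ^ r * ∏ i, 1 / (m.1 i : ℝ) := by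
  have : (2 : ℝ) ^ r = ∏ _i : Fin r, (2 : ℝ) := by simp
  rw [this, ← Finset.prod_mul_distrib]
  have hm : ∀ i, (1 : ℝ) ≤ m.1 i := fun i => by exact_mod_cast m.2.1 i
  refine Finset.prod_le_prod (fun i _ => one_div_nonneg.2 (by linarith [hm i])) (fun i _ => ?_)
  rw [mul_one_div, div_le_div_iff₀ (by linarith [hm i]) (by linarith [hm i])]
  linarith [hm i]

/-- The factors of the expansion in powers of `x` of the generating function of `ξ`. -/
noncomputable def xiFactor (x : ℝ) {r : ℕ} (m : StrictTuple r) : Fin (r + 1) → ℕ → ℝ :=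
  Fin.snoc (α := fun _ => ℕ → ℝ) (fun i j => x ^ j * (1 / (m.1 i : ℝ) ^ (j + 1)))
    (fun q => (-x) ^ q * completeHarmonic q (tupleMax m.1) / tupleMax m.1)

theorem prod_xiFactor (x : ℝ) {r : ℕ} (m : StrictTuple r) (κ : Fin (r + 1) → ℕ) :
    ∏ i, xiFactor x m i (κ i) = (x ^ (∑ i, κ i) * (-1) ^ κ (Fin.last r)) *
      xiTerm (fun i : Fin r => κ i.castSucc + 1) (κ (Fin.last r)) m := by
  rw [Fin.prod_univ_castSucc, Fin.sum_univ_castSucc]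
  simp only [xiFactor, Fin.snoc_castSucc, Fin.snoc_last, Finset.prod_mul_distrib, xiTerm,
    Finset.prod_pow_eq_pow_sum, pow_add]
  rw [neg_pow x]
  ring

/-- Each `1/(m_i - x)` is a geometric series and the last factor is the generating function of `h_q`
at `-x`. In the absolute version only the last factor changes, with `x` in place of `-x`. -/
theorem hasSum_xiFactor {x : ℝ} (h0 : 0 < x) (h1 : x ≤ 1 / 2) {r : ℕ} [NeZero r]
    (m : StrictTuple r) :
    HasSum (fun κ : Fin (r + 1) → ℕ => ∏ i, xiFactor x m i (κ i))
      ((∏ i, 1 / ((m.1 i : ℝ) - x)) *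
        ((∏ j ∈ Finset.range (tupleMax m.1), ((j : ℝ) + 1) / (j + 1 + x)) / tupleMax m.1)) ∧
    HasSum (fun κ : Fin (r + 1) → ℕ => |∏ i, xiFactor x m i (κ i)|)
      ((∏ i, 1 / ((m.1 i : ℝ) - x)) *
        ((∑' q, x ^ q * completeHarmonic q (tupleMax m.1)) / tupleMax m.1)) := by
  have hm : ∀ i, |x| < (m.1 i : ℝ) := fun i => by
    have : (1 : ℝ) ≤ m.1 i := by exact_mod_cast m.2.1 i
    rw [abs_of_pos h0]
    linarith
  have H := hasSum_pi_prod (f := xiFactor x m)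
    (a := Fin.snoc (α := fun _ => ℝ) (fun i => 1 / ((m.1 i : ℝ) - x))
      ((∏ j ∈ Finset.range (tupleMax m.1), ((j : ℝ) + 1) / (j + 1 + x)) / tupleMax m.1))
    (b := Fin.snoc (α := fun _ => ℝ) (fun i => 1 / ((m.1 i : ℝ) - x))
      ((∑' q, x ^ q * completeHarmonic q (tupleMax m.1)) / tupleMax m.1)) ?_ ?_
  · simpa only [Fin.prod_univ_castSucc, Fin.snoc_castSucc, Fin.snoc_last] using H
  · intro i
    refine Fin.lastCases ?_ (fun i => ?_) i
    · simp only [xiFactor, Fin.snoc_last]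
      exact (hasSum_neg_pow_mul_completeHarmonic h0.le (by linarith) _).div_const _
    · simp only [xiFactor, Fin.snoc_castSucc]
      exact hasSum_geometric_inv (hm i)
  · intro i
    refine Fin.lastCases ?_ (fun i => ?_) i
    · simp only [xiFactor, Fin.snoc_last]
      refine ((summable_pow_mul_completeHarmonic h0.le (by linarith)
        (tupleMax m.1)).hasSum.div_const (tupleMax m.1 : ℝ)).congr_of_eq fun q => ?_
      rw [abs_div, abs_mul, abs_pow, abs_neg, abs_of_pos h0, Nat.abs_cast,
        abs_of_nonneg (completeHarmonic_nonneg _ _)]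
    · simp only [xiFactor, Fin.snoc_castSucc]
      exact (hasSum_geometric_inv (hm i)).congr_of_eq fun j => abs_of_nonneg (by positivity)

/-- The alternating sum of the values of `ξ` of weight `k + r + 1`. -/
noncomputable def xiAlternatingSum (r k : ℕ) : ℝ :=
  ∑ κ ∈ Finset.Nat.antidiagonalTuple (r + 1) k, (-1) ^ κ (Fin.last r) *
    ∑' m, xiTerm (fun i : Fin r => κ i.castSucc + 1) (κ (Fin.last r)) m

theorem hasSum_xiAlternatingSum {x : ℝ} (h0 : 0 < x) (h1 : x ≤ 1 / 2) (r : ℕ) [NeZero r] :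
    HasSum (fun k => xiAlternatingSum r k * x ^ k)
      (∑' i : ℕ, starTailGen x (i + 1) / (((i : ℝ) + 1) * (i + 1 + x) ^ r)) := by
  have hsum : Summable fun p : StrictTuple r × (Fin (r + 1) → ℕ) =>
      ∏ i, xiFactor x p.1 i (p.2 i) := by
    refine Summable.of_abs ((summable_prod_of_nonneg fun p => abs_nonneg _).2
      ⟨fun m => (hasSum_xiFactor h0 h1 m).2.summable, ?_⟩)
    simp only [(hasSum_xiFactor h0 h1 _).2.tsum_eq]
    refine Summable.of_nonneg_of_le (fun m => ?_) (fun m => ?_)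
      ((summable_strictTuple r).mul_left (2 ^ r * 2))
    · rw [← (hasSum_xiFactor h0 h1 m).2.tsum_eq]
      exact tsum_nonneg fun κ => abs_nonneg _
    · have hM : (0 : ℝ) < tupleMax m.1 := by exact_mod_cast m.tupleMax_pos
      have h2 := div_le_div_sqrt hM (tsum_pow_mul_completeHarmonic_le h0.le h1 m.tupleMax_pos)
      calc _ ≤ (2 ^ r * ∏ i, 1 / (m.1 i : ℝ)) * (2 * (1 / Real.sqrt (tupleMax m.1))) :=
            mul_le_mul (prod_one_div_sub_le h1 m) h2
              (div_nonneg (tsum_nonneg fun q => mul_nonneg (by positivity)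
                (completeHarmonic_nonneg _ _)) hM.le) (by positivity)
        _ = _ := by ring
  have hS := hsum.hasSum
  -- Summing over exponents first gives the connected-sum value; summing over tuples first, and then
  -- grouping by total degree, gives the coefficients.
  have e := (hS.prod_fiberwise fun m => (hasSum_xiFactor h0 h1 m).1).unique
    (hasSum_strictTuple_generating h0.le h1 r)
  rw [e] at hS
  have hκ := ((Equiv.prodComm (Fin (r + 1) → ℕ) (StrictTuple r)).hasSum_iff.2 hS).prod_fiberwise
    (g := fun κ : Fin (r + 1) → ℕ => (x ^ (∑ i, κ i) * (-1) ^ κ (Fin.last r)) *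
      ∑' m, xiTerm (fun i : Fin r => κ i.castSucc + 1) (κ (Fin.last r)) m) fun κ => by
    refine ((summable_xiTerm (k := fun i : Fin r => κ i.castSucc + 1) (fun i => by omega)
      (κ (Fin.last r))).hasSum.mul_left _).congr_of_eq fun m => ?_
    exact prod_xiFactor x m κ
  refine (hκ.group_by_degree (fun κ => ∑ i, κ i) (Finset.Nat.antidiagonalTuple (r + 1))
    fun k κ => Finset.Nat.mem_antidiagonalTuple).congr_of_eq fun k => ?_
  rw [xiAlternatingSum, Finset.sum_mul]
  refine Finset.sum_congr rfl fun κ h => ?_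
  rw [Finset.Nat.mem_antidiagonalTuple.1 h]
  ring

/-- The pairs `(a, b)` with `a + 2 b = k`. -/
def weightPairs (k : ℕ) : Finset (ℕ × ℕ) :=
  (Finset.range (k + 1) ×ˢ Finset.range (k + 1)).filter fun p => p.1 + 2 * p.2 = k

theorem mem_weightPairs (k : ℕ) (p : ℕ × ℕ) : p ∈ weightPairs k ↔ p.1 + 2 * p.2 = k := by
  simp only [weightPairs, Finset.mem_filter, Finset.mem_product, Finset.mem_range]
  omega

/-- The sum of zeta-star values of weight `k + r + 1`. -/
noncomputable def zetaStarSum (r k : ℕ) : ℝ :=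
  ∑ p ∈ weightPairs k, (-1) ^ p.1 * ((p.1 + r - 1).choose (r - 1) : ℝ) *
    zetaStar (Fin.cons (α := fun _ => ℕ) (p.1 + r + 1) (fun _ : Fin p.2 => 2) :
      Fin (p.2 + 1) → ℕ)

/-- The negative binomial series in `y / N`, scaled by `1 / N^{r+1}`. -/
theorem hasSum_binomial_geometric {y N : ℝ} (hy : |y| < N) (r : ℕ) [NeZero r] :
    HasSum (fun a : ℕ => y ^ a * ((a + r - 1).choose (r - 1) : ℝ) * (1 / N ^ (a + r + 1)))
      (1 / (N * (N - y) ^ r)) := by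
  obtain ⟨s, rfl⟩ := Nat.exists_eq_succ_of_ne_zero (NeZero.ne r)
  have hN : 0 < N := (abs_nonneg y).trans_lt hy
  have hlt : ‖y / N‖ < 1 := by
    rw [norm_div, Real.norm_eq_abs, Real.norm_of_nonneg hN.le, div_lt_one hN]; exact hy
  have h := (hasSum_choose_mul_geometric_of_norm_lt_one s hlt).mul_right (1 / N ^ (s + 2))
  have hne : N - y ≠ 0 := by
    have := (le_abs_self y).trans_lt hy
    linarith
  convert! h using 1
  · funext a
    rw [Nat.succ_eq_add_one, show a + (s + 1) - 1 = a + s by omega, Nat.add_sub_cancel, div_pow,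
      show a + (s + 1) + 1 = a + (s + 2) by ring, pow_add N a]
    field_simp
  · rw [one_sub_div hN.ne', div_pow, Nat.succ_eq_add_one, pow_add N (s + 1) 1]
    field_simp

theorem hasSum_zetaStarSum {x : ℝ} (h0 : 0 < x) (h1 : x ≤ 1 / 2) (r : ℕ) [NeZero r] :
    HasSum (fun k => zetaStarSum r k * x ^ k)
      (∑' i : ℕ, starTailGen x (i + 1) / (((i : ℝ) + 1) * (i + 1 + x) ^ r)) := by
  set T : ℕ → ℕ × ℕ → ℝ := fun i p =>
    ((-x) ^ p.1 * ((p.1 + r - 1).choose (r - 1) : ℝ) * (1 / ((i : ℝ) + 1) ^ (p.1 + r + 1))) *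
      (x ^ (2 * p.2) * starTail p.2 (i + 1)) with hT
  have hi : ∀ i : ℕ, (0 : ℝ) ≤ i := fun i => Nat.cast_nonneg i
  have H : ∀ i : ℕ, HasSum (T i) (starTailGen x (i + 1) / (((i : ℝ) + 1) * (i + 1 + x) ^ r)) ∧
      HasSum (fun p => |T i p|)
        (1 / (((i : ℝ) + 1) * (i + 1 - x) ^ r) * starTailGen x (i + 1)) := by
    intro i
    have hx : |x| < (i : ℝ) + 1 := by rw [abs_of_pos h0]; linarith [hi i]
    have hQ := hasSum_starTailGen h0.le h1 (n := i + 1) (by omega)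
    have k1 := hasSum_binomial_geometric (y := -x) (N := (i : ℝ) + 1) (by rwa [abs_neg]) r
    have k2 := (hasSum_binomial_geometric hx r).congr_of_eq
      (g := fun a : ℕ => |(-x) ^ a * ((a + r - 1).choose (r - 1) : ℝ) *
        (1 / ((i : ℝ) + 1) ^ (a + r + 1))|) fun a => by
      rw [abs_mul, abs_mul, abs_pow, abs_neg, abs_of_pos h0, Nat.abs_cast,
        abs_of_nonneg (by positivity : (0 : ℝ) ≤ 1 / ((i : ℝ) + 1) ^ (a + r + 1))]
    obtain ⟨j1, j2⟩ := k1.mul_of_abs k2 hQ (hQ.congr_of_eq fun b =>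
      abs_of_nonneg (mul_nonneg (by positivity) (starTail_nonneg _ _)))
    refine ⟨?_, j2⟩
    convert! j1 using 1
    rw [sub_neg_eq_add]
    ring
  have hsum : Summable fun q : ℕ × (ℕ × ℕ) => T q.1 q.2 := by
    refine Summable.of_abs ((summable_prod_of_nonneg fun p => abs_nonneg _).2
      ⟨fun i => (H i).2.summable, ?_⟩)
    simp only [(H _).2.tsum_eq]
    refine Summable.of_nonneg_of_le (fun i => ?_) (fun i => ?_)
      ((summable_inv_sq (n := 1) one_pos).mul_left (2 ^ r * 2))
    · rw [← (H i).2.tsum_eq]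
      exact tsum_nonneg fun p => abs_nonneg _
    · have h3 : ((i : ℝ) + 1) / 2 ^ r ≤ (i + 1 - x) ^ r := by
        calc ((i : ℝ) + 1) / 2 ^ r ≤ ((i : ℝ) + 1) ^ r / 2 ^ r := by
              gcongr
              exact le_self_pow₀ (by linarith [hi i]) (NeZero.ne r)
          _ = (((i : ℝ) + 1) / 2) ^ r := (div_pow _ _ _).symm
          _ ≤ _ := by
              refine pow_le_pow_left₀ (by linarith [hi i]) ?_ r
              linarith [hi i]
      have h4 : 1 / (((i : ℝ) + 1) * (i + 1 - x) ^ r) ≤ 2 ^ r * (1 / ((i : ℝ) + 1) ^ 2) := by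
        calc _ ≤ 1 / (((i : ℝ) + 1) * (((i : ℝ) + 1) / 2 ^ r)) := by gcongr
          _ = _ := by field_simp
      have h5 := starTailGen_le_two h0.le h1 (n := i + 1) (by omega)
      calc _ ≤ 2 ^ r * (1 / ((i : ℝ) + 1) ^ 2) * 2 := by
            refine mul_le_mul h4 h5 ?_ (by positivity)
            linarith [one_le_starTailGen h0.le h1 (n := i + 1) (by omega)]
        _ = _ := by push_cast; ring
  have hS := hsum.hasSum
  have e := (hS.prod_fiberwise fun i => (H i).1).tsum_eq
  rw [← e] at hS
  have hp := ((Equiv.prodComm (ℕ × ℕ) ℕ).hasSum_iff.2 hS).prod_fiberwise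
    (g := fun p : ℕ × ℕ => ((-x) ^ p.1 * ((p.1 + r - 1).choose (r - 1) : ℝ) * x ^ (2 * p.2)) *
      zetaStar (Fin.cons (α := fun _ => ℕ) (p.1 + r + 1) (fun _ : Fin p.2 => 2) :
        Fin (p.2 + 1) → ℕ)) fun p => by
    have hr := Nat.pos_of_ne_zero (NeZero.ne r)
    refine ((hasSum_zetaStar (c := p.1 + r + 1) (by omega) p.2).mul_left _).congr_of_eq fun i => ?_
    simp only [Function.comp, hT, Equiv.prodComm_apply, Prod.swap]
    ring
  refine (hp.group_by_degree (fun p => p.1 + 2 * p.2) weightPairs mem_weightPairs).congr_of_eq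
    fun k => ?_
  rw [zetaStarSum, Finset.sum_mul]
  refine Finset.sum_congr rfl fun p h => ?_
  have hk := (mem_weightPairs k p).1 h
  rw [← hk, pow_add, neg_pow x]
  ring

theorem xiAlternatingSum_eq_zetaStarSum (r : ℕ) [NeZero r] (k : ℕ) :
    xiAlternatingSum r k = zetaStarSum r k :=
  congrFun (coeff_eq_of_hasSum_eq (ρ := 1 / 2) (by norm_num) fun _ h0 h1 =>
    ⟨_, hasSum_xiAlternatingSum h0 h1 r, hasSum_zetaStarSum h0 h1 r⟩) k

end

/-! ### Elementary harmonic sums and the identity (1). -/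

/-- The elementary symmetric polynomial of degree `r` in `1, 1/2, …, 1/M`. -/
noncomputable def elementaryHarmonic : ℕ → ℕ → ℝ
  | 0, _ => 1
  | r + 1, M => ∑ j ∈ Finset.range M, elementaryHarmonic r j / (j + 1)

theorem elementaryHarmonic_nonneg (r M : ℕ) : 0 ≤ elementaryHarmonic r M := by
  induction r generalizing M with
  | zero => rw [elementaryHarmonic]; exact zero_le_one
  | succ r ih =>
    rw [elementaryHarmonic]
    exact Finset.sum_nonneg fun j _ => div_nonneg (ih _) (by positivity)

theorem ENNReal.tsum_nat_add_eq_tsum_ite (h : ℕ → ENNReal) (l : ℕ) :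
    ∑' j, h (l + 1 + j) = ∑' M, if l < M then h M else 0 := by
  have hinj : Function.Injective fun j : ℕ => l + 1 + j := add_right_injective _
  have hsupp : Function.support (fun M => if l < M then h M else 0) ⊆
      Set.range fun j : ℕ => l + 1 + j := by
    intro M hM
    have : l < M := by
      by_contra hc
      simp [hc] at hM
    exact ⟨M - (l + 1), by simp only; omega⟩
  rw [← hinj.tsum_eq hsupp]
  refine tsum_congr fun j => ?_
  rw [if_pos (by omega)]

theorem tsum_strictTuple_snoc {r : ℕ} (F : StrictTuple (r + 1) → ENNReal) :
    ∑' m, F m = ∑' m : StrictTuple r, ∑' j : ℕ, F (strictTupleSnocEquiv r (m, j)) := by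
  rw [← (strictTupleSnocEquiv r).tsum_eq]
  exact ENNReal.tsum_prod'

/-- Summation over the tuples with a given last entry. -/
theorem tsum_strictTuple_succ (r : ℕ) (g : ℕ → ENNReal) :
    ∑' m : StrictTuple (r + 1), ENNReal.ofReal (∏ i, 1 / (m.1 i : ℝ)) * g (tupleMax m.1) =
      ∑' l : ℕ, ENNReal.ofReal (elementaryHarmonic r l / (l + 1)) * g (l + 1) := by
  induction r generalizing g with
  | zero =>
    have : Unique (StrictTuple 0) :=
      ⟨⟨⟨Fin.elim0, fun i => i.elim0, fun i => i.elim0⟩⟩, fun m => Subtype.ext (Subsingleton.elim _ _)⟩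
    rw [tsum_strictTuple_snoc, tsum_fintype, Fintype.sum_unique]
    refine tsum_congr fun j => ?_
    rw [prod_strictTupleSnocEquiv (fun n : ℕ => 1 / (n : ℝ)), tupleMax_strictTupleSnocEquiv]
    have : tupleMax (default : StrictTuple 0).1 = 0 := by simp [tupleMax]
    rw [this]
    simp [elementaryHarmonic, add_comm]
  | succ r ih =>
    rw [tsum_strictTuple_snoc]
    have e1 : ∀ m : StrictTuple (r + 1), ∑' j : ℕ,
        ENNReal.ofReal (∏ i, 1 / ((strictTupleSnocEquiv (r + 1) (m, j)).1 i : ℝ)) *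
          g (tupleMax (strictTupleSnocEquiv (r + 1) (m, j)).1) =
        ENNReal.ofReal (∏ i, 1 / (m.1 i : ℝ)) * (fun a : ℕ => ∑' j : ℕ,
          ENNReal.ofReal (1 / ((a + 1 + j : ℕ) : ℝ)) * g (a + 1 + j)) (tupleMax m.1) := by
      intro m
      rw [← ENNReal.tsum_mul_left]
      refine tsum_congr fun j => ?_
      rw [prod_strictTupleSnocEquiv (fun n : ℕ => 1 / (n : ℝ)), tupleMax_strictTupleSnocEquiv,
        ENNReal.ofReal_mul (by positivity), mul_assoc]
    refine (tsum_congr e1).trans ((ih fun a : ℕ => ∑' j : ℕ,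
      ENNReal.ofReal (1 / ((a + 1 + j : ℕ) : ℝ)) * g (a + 1 + j)).trans ?_)
    have e2 : ∀ l : ℕ, ∑' j : ℕ,
        ENNReal.ofReal (1 / ((l + 1 + 1 + j : ℕ) : ℝ)) * g (l + 1 + 1 + j) =
        ∑' M : ℕ, if l < M then ENNReal.ofReal (1 / ((M + 1 : ℕ) : ℝ)) * g (M + 1) else 0 := by
      intro l
      rw [← ENNReal.tsum_nat_add_eq_tsum_ite (fun M : ℕ =>
        ENNReal.ofReal (1 / ((M + 1 : ℕ) : ℝ)) * g (M + 1)) l]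
      refine tsum_congr fun j => ?_
      rw [show l + 1 + 1 + j = l + 1 + j + 1 by ring]
    simp only [e2]
    simp only [← ENNReal.tsum_mul_left]
    -- The extended nonnegative reals allow this exchange without convergence hypotheses; the cutoff
    -- `l < M` then turns the inner series into the finite sum defining `elementaryHarmonic`.
    rw [ENNReal.tsum_comm]
    refine tsum_congr fun M => ?_
    rw [tsum_eq_sum (s := Finset.range M) (fun l hl => by
      rw [if_neg (by simpa using hl), mul_zero])]
    rw [elementaryHarmonic, Finset.sum_div, ENNReal.ofReal_sum_of_nonneg (fun l _ =>
      div_nonneg (div_nonneg (elementaryHarmonic_nonneg _ _) (by positivity)) (by positivity)),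
      Finset.sum_mul]
    refine Finset.sum_congr rfl fun l hl => ?_
    rw [if_pos (Finset.mem_range.1 hl), ← mul_assoc, ← ENNReal.ofReal_mul
      (div_nonneg (elementaryHarmonic_nonneg _ _) (by positivity))]
    push_cast
    rw [mul_one_div]

/-- Fixing the last entry `l + 1`, the smaller entries sum to `elementaryHarmonic r l`. Summability
of `xiTerm` brings the extended identity back to the reals. -/
theorem hasSum_xiTerm_ones (r k q : ℕ) :
    HasSum (fun l : ℕ => elementaryHarmonic r l * (1 / ((l : ℝ) + 1) ^ (k + 1)) *
        (completeHarmonic q (l + 1) / (l + 1)))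
      (∑' m, xiTerm (Fin.snoc (α := fun _ => ℕ) (fun _ : Fin r => 1) (k + 1) : Fin (r + 1) → ℕ)
        q m) := by
  set κ : Fin (r + 1) → ℕ := Fin.snoc (α := fun _ => ℕ) (fun _ : Fin r => 1) (k + 1) with hκ
  -- One of the `k + 1` powers of the last entry stays in the common product of inverses, so the
  -- weight `g` below carries only `k`.
  have hκ1 : ∀ i, 1 ≤ κ i := fun i =>
    Fin.lastCases (by simp [hκ]) (fun i => by simp [hκ]) i
  set g : ℕ → ℝ := fun M => 1 / (M : ℝ) ^ k * (completeHarmonic q M / M) with hg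
  have hg0 : ∀ M, 0 ≤ g M := fun M =>
    mul_nonneg (by positivity) (div_nonneg (completeHarmonic_nonneg _ _) (by positivity))
  have hterm : ∀ m : StrictTuple (r + 1), xiTerm κ q m =
      (∏ i, 1 / (m.1 i : ℝ)) * g (tupleMax m.1) := by
    intro m
    have hM : tupleMax m.1 = m.1 (Fin.last r) := m.tupleMax_eq
    have : ∏ i, 1 / (m.1 i : ℝ) ^ κ i = (∏ i, 1 / (m.1 i : ℝ)) * (1 / (tupleMax m.1 : ℝ) ^ k) := by
      rw [Fin.prod_univ_castSucc, Fin.prod_univ_castSucc, hM]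
      simp only [hκ, Fin.snoc_castSucc, Fin.snoc_last, pow_one]
      rw [pow_succ]
      ring
    rw [xiTerm, this, mul_assoc]
  have hnn : ∀ l : ℕ, 0 ≤ elementaryHarmonic r l / ((l : ℝ) + 1) := fun l =>
    div_nonneg (elementaryHarmonic_nonneg _ _) (by positivity)
  have h1 := tsum_strictTuple_succ r (fun M => ENNReal.ofReal (g M))
  simp only [← ENNReal.ofReal_mul (Finset.prod_nonneg fun i _ =>
    one_div_nonneg.2 (Nat.cast_nonneg (α := ℝ) _)), ← hterm, ← ENNReal.ofReal_mul (hnn _)] at h1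
  rw [← ENNReal.ofReal_tsum_of_nonneg (fun m => xiTerm_nonneg κ q m) (summable_xiTerm hκ1 q)] at h1
  have h2 := ENNReal.hasSum_toReal (f := fun l : ℕ =>
    ENNReal.ofReal (elementaryHarmonic r l / ((l : ℝ) + 1) * g (l + 1)))
    (by rw [← h1]; exact ENNReal.ofReal_ne_top)
  rw [← ENNReal.tsum_toReal_eq (fun l => ENNReal.ofReal_ne_top), ← h1,
    ENNReal.toReal_ofReal (tsum_nonneg fun m => xiTerm_nonneg κ q m)] at h2
  refine h2.congr_of_eq fun l => ?_
  rw [ENNReal.toReal_ofReal (mul_nonneg (hnn l) (hg0 _)), hg]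
  push_cast
  rw [pow_succ]
  field_simp

open PowerSeries in
-- The two series are `∏ (1 + x/j)` and its inverse; each step in `M` moves one linear factor
-- across.
theorem elementary_mul_complete (M : ℕ) :
    (mk fun r => elementaryHarmonic r M) * (mk fun q => (-1) ^ q * completeHarmonic q M) =
      (1 : PowerSeries ℝ) := by
  induction M with
  | zero =>
    have e1 : (mk fun r => elementaryHarmonic r 0) = (1 : PowerSeries ℝ) := by
      ext n; cases n <;> simp [elementaryHarmonic, coeff_one]
    have e2 : (mk fun q => (-1) ^ q * completeHarmonic q 0) = (1 : PowerSeries ℝ) := by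
      ext n; cases n <;> simp [completeHarmonic, coeff_one]
    rw [e1, e2, one_mul]
  | succ M ih =>
    have e1 : (mk fun r => elementaryHarmonic r (M + 1)) =
        (mk fun r => elementaryHarmonic r M) * (1 + C (1 / ((M : ℝ) + 1)) * X) := by
      ext n
      cases n with
      | zero => simp [elementaryHarmonic]
      | succ n =>
        rw [mul_add, mul_one, mul_left_comm, ← mul_assoc, map_add, coeff_succ_mul_X, coeff_C_mul]
        simp [elementaryHarmonic, Finset.sum_range_succ, div_eq_inv_mul]
    have e2 : (mk fun q => (-1) ^ q * completeHarmonic q M) =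
        (1 + C (1 / ((M : ℝ) + 1)) * X) * (mk fun q => (-1) ^ q * completeHarmonic q (M + 1)) := by
      ext n
      cases n with
      | zero => simp [completeHarmonic_zero]
      | succ n =>
        rw [add_mul, one_mul, mul_assoc, map_add, coeff_C_mul, coeff_succ_X_mul]
        simp only [coeff_mk, completeHarmonic_succ_succ]
        ring
    rw [e1, mul_assoc, ← e2, ih]

open PowerSeries in
theorem generating_ones_identity (M : ℕ) :
    (mk fun r => elementaryHarmonic r M) * ((mk fun k => 1 / ((M : ℝ) + 1) ^ (k + 1)) *
      (mk fun q => (-1) ^ q * (completeHarmonic q (M + 1) / (M + 1)))) =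
      mk fun k => if Even k then 1 / ((M : ℝ) + 1) ^ (k + 2) else 0 := by
  have hN : (M : ℝ) + 1 ≠ 0 := by positivity
  set N : ℝ := (M : ℝ) + 1 with hNd
  have e1 : (C N - X) * (mk fun k => 1 / N ^ (k + 1)) = 1 := by
    ext n
    cases n with
    | zero => simp [sub_mul, hN]
    | succ n =>
      rw [sub_mul, map_sub, coeff_C_mul, coeff_succ_X_mul, coeff_mk, coeff_mk, coeff_one]
      simp only [Nat.add_one_ne_zero, if_false]
      field_simp
      ring
  have e2 : (C N + X) * (mk fun q => (-1) ^ q * (completeHarmonic q (M + 1) / N)) =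
      mk fun q => (-1) ^ q * completeHarmonic q M := by
    ext n
    cases n with
    | zero => simp [add_mul, completeHarmonic_zero, hN]
    | succ n =>
      rw [add_mul, map_add, coeff_C_mul, coeff_succ_X_mul]
      simp only [coeff_mk, completeHarmonic_succ_succ, ← hNd]
      field_simp
      ring
  have e3 : ((C N - X) * (C N + X)) * (mk fun k => if Even k then 1 / N ^ (k + 2) else 0) = 1 := by
    have : ((C N - X) * (C N + X)) = C (N ^ 2) - X * X := by
      rw [map_pow]; ring
    rw [this]
    ext n
    rcases n with _ | _ | n
    · simp [sub_mul, hN]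
    · rw [sub_mul, map_sub, coeff_C_mul, mul_assoc, coeff_succ_X_mul]
      simp [coeff_one]
    · rw [sub_mul, map_sub, coeff_C_mul, mul_assoc, coeff_succ_X_mul, coeff_succ_X_mul]
      simp only [coeff_mk, coeff_one, Nat.even_add_one, not_not]
      split_ifs <;> simp_all
      field_simp
      ring
  have e4 := elementary_mul_complete M
  rw [← e2] at e4
  set A : PowerSeries ℝ := mk fun r => elementaryHarmonic r M
  set B : PowerSeries ℝ := mk fun q => (-1) ^ q * (completeHarmonic q (M + 1) / N)
  set D : PowerSeries ℝ := mk fun k => 1 / N ^ (k + 1)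
  set E : PowerSeries ℝ := mk fun k => if Even k then 1 / N ^ (k + 2) else 0
  -- Here `D` and `E` are the inverses of `N - x` and `(N - x)(N + x)`, and `e4` says `A (N + x) B =
  -- 1`, so `A D B = E`.
  linear_combination E * ((C N - X) * D) * e4 + E * e1 - A * (D * B) * e3

theorem sum_antidiagonalTuple_three (k : ℕ) (f : ℕ → ℕ → ℕ → ℝ) :
    ∑ p ∈ Finset.Nat.antidiagonalTuple 3 k, f (p 0) (p 1) (p 2) =
      ∑ x ∈ Finset.HasAntidiagonal.antidiagonal k, ∑ y ∈ Finset.HasAntidiagonal.antidiagonal x.2, f x.1 y.1 y.2 := by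
  rw [Finset.sum_sigma']
  refine Finset.sum_nbij' (fun p => ⟨(p 0, p 1 + p 2), (p 1, p 2)⟩)
    (fun s => ![s.1.1, s.2.1, s.2.2]) ?_ ?_ ?_ ?_ ?_
  · intro p hp
    rw [Finset.Nat.mem_antidiagonalTuple, Fin.sum_univ_three] at hp
    simp [← hp, add_assoc]
  · rintro ⟨⟨a, b⟩, c, d⟩ hp
    simp only [Finset.mem_sigma, Finset.HasAntidiagonal.mem_antidiagonal] at hp
    rw [Finset.Nat.mem_antidiagonalTuple, Fin.sum_univ_three]
    simp
    omega
  · intro p _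
    ext i
    fin_cases i <;> rfl
  · rintro ⟨⟨a, b⟩, c, d⟩ hp
    simp only [Finset.mem_sigma, Finset.HasAntidiagonal.mem_antidiagonal] at hp
    obtain ⟨h1, rfl⟩ := hp
    rfl
  · intro p _
    rfl

theorem sum_ones_identity (k M : ℕ) :
    ∑ p ∈ Finset.Nat.antidiagonalTuple 3 k, (-1) ^ p 2 *
      (elementaryHarmonic (p 0) M * (1 / ((M : ℝ) + 1) ^ (p 1 + 1)) *
        (completeHarmonic (p 2) (M + 1) / (M + 1))) =
      if Even k then 1 / ((M : ℝ) + 1) ^ (k + 2) else 0 := by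
  have h := congrArg (PowerSeries.coeff k) (generating_ones_identity M)
  simp only [PowerSeries.coeff_mul, PowerSeries.coeff_mk, Finset.mul_sum] at h
  rw [← h, sum_antidiagonalTuple_three k (fun a b c => (-1) ^ c *
    (elementaryHarmonic a M * (1 / ((M : ℝ) + 1) ^ (b + 1)) *
      (completeHarmonic c (M + 1) / (M + 1))))]
  refine Finset.sum_congr rfl fun x _ => Finset.sum_congr rfl fun y _ => ?_
  ring

theorem hasSum_ones_identity (k : ℕ) :
    HasSum (fun l : ℕ => if Even k then 1 / ((l : ℝ) + 1) ^ (k + 2) else 0)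
      (∑ p ∈ Finset.Nat.antidiagonalTuple 3 k, (-1) ^ p 2 *
        ∑' m, xiTerm (Fin.snoc (α := fun _ => ℕ) (fun _ : Fin (p 0) => 1) (p 1 + 1) :
          Fin (p 0 + 1) → ℕ) (p 2) m) :=
  HasSum.congr_of_eq (hasSum_sum fun p _ =>
    (hasSum_xiTerm_ones (p 0) (p 1) (p 2)).mul_left ((-1) ^ p 2))
    fun l => (sum_ones_identity k l).symm

theorem sum_xi_ones (k : ℕ) :
    ((∑ p ∈ Finset.Nat.antidiagonalTuple 3 k, (-1) ^ p 2 *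
        ∑' m, xiTerm (Fin.snoc (α := fun _ => ℕ) (fun _ : Fin (p 0) => 1) (p 1 + 1) :
          Fin (p 0 + 1) → ℕ) (p 2) m : ℝ) : ℂ) =
      if Even k then riemannZeta ((k : ℂ) + 2) else 0 := by
  have h := hasSum_ones_identity k
  split_ifs with hk
  · simp only [hk, if_true] at h
    have hz := zeta_nat_eq_tsum_of_gt_one (k := k + 2) (by omega)
    push_cast at hz
    have hs := (hasSum_nat_add_iff (f := fun n : ℕ => 1 / (n : ℝ) ^ (k + 2)) 1).1
      (h.congr_of_eq fun l => by push_cast; rfl)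
    -- The zeta series is indexed from `n = 0`, whose term is `1 / 0 = 0`, so the shift by one costs
    -- nothing.
    rw [Finset.sum_range_one, Nat.cast_zero, zero_pow (by omega), div_zero, add_zero] at hs
    rw [hz, ← hs.tsum_eq, Complex.ofReal_tsum]
    push_cast
    rfl
  · simp only [hk, if_false] at h
    rw [h.unique hasSum_zero]
    simp

/-! ### Passage from the real series to the complex values. -/

theorem theorem2p6 :
    -- every value of `ξ` and `ζ⋆` that occurs below is given by a convergent series or integral
    (∀ (r : ℕ) [NeZero r] (k : Fin r → ℕ) (m : ℕ), (∀ i, 1 ≤ k i) → 1 ≤ m →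
      XiConverges k (m : ℂ)) ∧
    (∀ (r : ℕ) [NeZero r] (k : Fin r → ℕ), IsAdmissible k → Summable (zetaStarTerm k)) ∧
    -- (1): here `p = (r, k₁, k₂)`
    (∀ k : ℕ,
      ∑ p ∈ Finset.Nat.antidiagonalTuple 3 k,
          (-1 : ℂ) ^ p 2 *
            arakawaKanekoXi
              (Fin.snoc (α := fun _ => ℕ) (fun _ : Fin (p 0) => 1) (p 1 + 1) : Fin (p 0 + 1) → ℕ)
              ((p 2 : ℂ) + 1) =
        if Even k then riemannZeta ((k : ℂ) + 2) else 0) ∧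
    -- (2): here `κ = (k₁, …, k_{r+1})` and `p = (a, b)`
    (∀ (r : ℕ) [NeZero r] (k : ℕ),
      ∑ κ ∈ Finset.Nat.antidiagonalTuple (r + 1) k,
          (-1 : ℂ) ^ κ (Fin.last r) *
            arakawaKanekoXi (fun i : Fin r => κ i.castSucc + 1) ((κ (Fin.last r) : ℂ) + 1) =
        ∑ p ∈ (Finset.range (k + 1) ×ˢ Finset.range (k + 1)).filter (fun p => p.1 + 2 * p.2 = k),
          (-1 : ℂ) ^ p.1 * ((p.1 + r - 1).choose (r - 1) : ℂ) *
            (zetaStar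
              (Fin.cons (α := fun _ => ℕ) (p.1 + r + 1) (fun _ : Fin p.2 => 2) :
                Fin (p.2 + 1) → ℕ) : ℂ)) := by
  refine ⟨fun r _ k m hk hm => ?_, fun r _ k hk => summable_zetaStarTerm hk, fun k => ?_,
    fun r _ k => ?_⟩
  · obtain ⟨q, rfl⟩ := Nat.exists_eq_add_of_le' hm
    push_cast
    exact (xiConverges_and_eq hk q).1
  · rw [← sum_xi_ones k]
    push_cast
    refine Finset.sum_congr rfl fun p _ => ?_
    rw [(xiConverges_and_eq (fun i => Fin.lastCases (by simp) (fun i => by simp) i) _).2]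
    push_cast
    rfl
  · have h := congrArg (fun t : ℝ => (t : ℂ)) (xiAlternatingSum_eq_zetaStarSum r k)
    simp only [xiAlternatingSum, zetaStarSum, weightPairs] at h
    push_cast at h
    rw [← h]
    refine Finset.sum_congr rfl fun κ _ => ?_
    rw [(xiConverges_and_eq (k := fun i : Fin r => κ i.castSucc + 1) (fun i => by omega) _).2]
    push_cast
    rfl
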